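/- Let $D$ be a diagram on the sphere $S^2$ of an oriented knot $K$ (a planar signed Gauss code; the diagram without crossings is allowed). **Alexander polynomial.** Let $a_0$ be any face of $D$, regarded as the unbounded one. The knot group $\pi$ has the Dehn presentation with one generator $A_y$ for each face $y\ne a_0$ (put $A_{a_0}=1$) and, for each crossing $c$, the relator $r_c=A_4A_2^{-1}(A_3A_1^{-1})^{-1}$, where $a_1,a_2,a_3,a_4$ are the faces to the north, west, east and south of $c$ when the over-strand runs from south-west to north-east. Let $\psi:\mathbb Z[\pi]\to\mathbb Z[t^{\pm1}]$ be induced by the abelianization map that takes each positive meridian $A_{\mathrm{right}}A_{\mathrm{left}}^{-1}$ of an edge of $D$ to $t$, and let $M$ be the matrix with entries $\psi(\partial r_c/\partial A_y)$ (Fox derivatives, mapped to $\mathbb Z[\pi]$). $\Delta_K(t)$ is defined up to multiplication by $\pm t^k$, $k\in\mathbb Z$ (written $\doteq$), as the determinant of the square matrix that is left when the column of a face adjacent to $a_0$ is deleted from $M$. **Alexander graph.** Let $f,g$ be two adjacent faces of $D$. The bipartite graph $\Gamma$ has as vertices the crossings of $D$ on one side and the faces of $D$ other than $f,g$ on the other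 side, with one edge for each corner of such a face at a crossing. It is a plane graph: put a vertex in each face, join it to the corners of the face, delete the vertices $f$ and $g$, and put the point at infinity in $f$. A dimer covering $m$ of $\Gamma$ is a perfect matching. Let $\alpha$ be the weighting of the edges by $t,t,1,1$ at each crossing: $t$ for the two corners on the left of the over-strand and $1$ for the two on its right. A Kasteleyn weighting $\epsilon$ of $\Gamma$ assigns $\pm1$ to each edge such that each bounded face with $0$ mod $4$ edges has an odd number, and each bounded face with $2$ mod $4$ edges an even number, of $-1$ assignments (edges on the boundary walk being counted with multiplicity). Put $$Z(\Gamma_{\epsilon\alpha})=\sum_{m}\ \prod_{e\in m}\epsilon(e)\,\alpha(e),$$ the sum being over all dimer coverings $m$ of $\Gamma$. **Proposition.** 1. For every Kasteleyn weighting $\epsilon$ of $\Gamma$ one has $\Delta_K(t)\doteq Z(\Gamma_{\epsilon\alpha})$. More precisely, whichever $a_0$ is used, the Laurent polynomials that arise as $\Delta_K(t)$ in the definition above are exactly the polynomials $\pm t^kZ(\Gamma_{\epsilon\alpha})$. 2. Kauffman's weighting $\epsilon_0$, which is $-1$ at the corner between the two outgoing ends of the strands at each crossing and $+1$ at the other corners,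 is a Kasteleyn weighting of $\Gamma$. 3. $Z(\Gamma_{\epsilon_0\alpha})$ equals Kauffman's state sum: the sum over all states (ways to place one marker at a corner of each crossing so that $f$ and $g$ have no marker and each other face has exactly one) of the product of the weights $\epsilon_0\alpha$ at the markers. -/

import Mathlib

open scoped LaurentPolynomial

/-! ### Bipartite graphs, dimer coverings and the partition function -/

/-- A bipartite (multi)graph with vertex sets `V₁`, `V₂` and edge set `E`. -/
structure BipartiteGraph (V₁ V₂ E : Type*) where
  end₁ : E → V₁
  end₂ : E → V₂

namespace BipartiteGraph

variable {V₁ V₂ E R : Type*}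

/-- A dimer covering (perfect matching): every vertex is an endpoint of exactly one edge of `m`. -/
def IsDimerCovering (Γ : BipartiteGraph V₁ V₂ E) (m : Finset E) : Prop :=
  (∀ v : V₁, ∃! e, e ∈ m ∧ Γ.end₁ e = v) ∧ (∀ v : V₂, ∃! e, e ∈ m ∧ Γ.end₂ e = v)

open Classical in
/-- The partition function: the sum over all dimer coverings `m` of the product of the weights
of the edges in `m`. -/
noncomputable def partitionFunction [Fintype E] [CommRing R] (Γ : BipartiteGraph V₁ V₂ E)
    (μ : E → R) : R :=
  ∑ m : Finset E with Γ.IsDimerCovering m, ∏ e ∈ m, μ e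

end BipartiteGraph

/-! ### Fox's free derivatives -/

section Fox

variable {α : Type*}

open Classical in
/-- The free derivative with respect to `i` of a letter: `(j, true)` is the generator `j`,
`(j, false)` its inverse. -/
noncomputable def foxLetter (i : α) : α × Bool → MonoidAlgebra ℤ (FreeGroup α)
  | (j, true) => if j = i then 1 else 0
  | (j, false) => if j = i then -MonoidAlgebra.of ℤ (FreeGroup α) (FreeGroup.of j)⁻¹ else 0

/-- The free derivative of a (not necessarily reduced) word. -/
noncomputable def foxWord (i : α) : List (α × Bool) → MonoidAlgebra ℤ (FreeGroup α)
  | [] => 0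
  | a :: w => foxLetter i a + MonoidAlgebra.of ℤ (FreeGroup α) (FreeGroup.mk [a]) * foxWord i w

theorem foxWord_append (i : α) (v w : List (α × Bool)) :
    foxWord i (v ++ w) =
      foxWord i v + MonoidAlgebra.of ℤ (FreeGroup α) (FreeGroup.mk v) * foxWord i w := by
  induction v with
  | nil =>
    have h : (FreeGroup.mk ([] : List (α × Bool))) = 1 := rfl
    simp [foxWord, h, ← MonoidAlgebra.one_def]
  | cons a v ih =>
    have h : FreeGroup.mk (a :: v) = FreeGroup.mk [a] * FreeGroup.mk v := by
      rw [FreeGroup.mul_mk]; rfl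
    rw [List.cons_append, foxWord, foxWord, ih, h, map_mul]
    noncomm_ring

theorem foxWord_cancel (i x : α) (b : Bool) : foxWord i [(x, b), (x, !b)] = 0 := by
  have h1 : FreeGroup.mk [(x, true)] = FreeGroup.of x := rfl
  have h2 : FreeGroup.mk [(x, false)] = (FreeGroup.of x)⁻¹ := rfl
  by_cases hx : x = i
  · subst hx
    cases b <;> simp [foxWord, foxLetter, h1, h2, MonoidAlgebra.one_def,
      MonoidAlgebra.single_mul_single]
  · cases b <;> simp [foxWord, foxLetter, hx]

theorem foxWord_step (i : α) (v w : List (α × Bool)) (h : FreeGroup.Red.Step v w) :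
    foxWord i v = foxWord i w := by
  cases h with
  | @not L₁ L₂ x b =>
    have h0 : FreeGroup.mk (L₁ ++ [(x, b), (x, !b)]) = FreeGroup.mk L₁ := by
      have hs := FreeGroup.Red.Step.not (L₁ := L₁) (L₂ := []) (x := x) (b := b)
      rw [List.append_nil] at hs
      exact Quot.sound hs
    have h1 : L₁ ++ (x, b) :: (x, !b) :: L₂ = (L₁ ++ [(x, b), (x, !b)]) ++ L₂ := by simp
    rw [h1, foxWord_append, foxWord_append, foxWord_cancel, h0, foxWord_append]
    simp

/-- Fox's free derivative `∂/∂i` from the free group to its integral group ring. -/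
noncomputable def foxDeriv (i : α) : FreeGroup α → MonoidAlgebra ℤ (FreeGroup α) :=
  Quot.lift (foxWord i) (foxWord_step i)

theorem foxDeriv_one (i : α) : foxDeriv i 1 = 0 := rfl

open Classical in
theorem foxDeriv_of (i j : α) : foxDeriv i (FreeGroup.of j) = if j = i then 1 else 0 := by
  change foxWord i [(j, true)] = _
  simp [foxWord, foxLetter]

open Classical in
theorem foxDeriv_inv_of (i j : α) : foxDeriv i (FreeGroup.of j)⁻¹ =
    if j = i then -MonoidAlgebra.of ℤ (FreeGroup α) (FreeGroup.of j)⁻¹ else 0 := by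
  change foxWord i [(j, false)] = _
  simp [foxWord, foxLetter]

theorem foxDeriv_mul (i : α) (v w : FreeGroup α) :
    foxDeriv i (v * w) = foxDeriv i v + MonoidAlgebra.of ℤ (FreeGroup α) v * foxDeriv i w := by
  induction v using Quot.ind with
  | mk v => induction w using Quot.ind with
    | mk w => exact foxWord_append i v w

end Fox

/-! ### Knot diagrams -/

/-- The two sides of an oriented edge. -/
inductive EdgeSide
  | left
  | right

/-- The underlying data of a diagram (on an oriented surface) of an oriented knot: a signed Gauss
code with crossing set `X`. A *passage* `(c, true)` or `(c, false)` is a visit of the knot to the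
crossing `c` along the over- or the under-strand; `next p` is the passage that follows `p`
along the knot, and all passages form one cycle. -/
structure GaussCode (X : Type*) where
  /-- `true` for a positive (right-handed) crossing, `false` for a negative one -/
  positive : X → Bool
  next : Equiv.Perm (X × Bool)
  single_cycle : ∀ p q, next.SameCycle p q

namespace GaussCode

variable {X : Type*} (D : GaussCode X)

/-- The edges of the diagram: for each passage `p` the edge that leaves `p` and arrives at `next p`;
if there are no crossings, there is just one closed edge, the whole circle. -/
inductive Edge (D : GaussCode X)
  | leaving (p : X × Bool)
  | circle (h : IsEmpty X)

/-! Turn a crossing such that its over-strand runs from the south-west to the north-east.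
Its four *rays* are numbered counterclockwise: ray `0` is north-east, `1` north-west,
`2` south-west and `3` south-east. Its four *corners* are numbered so that corner `i` lies between
ray `i` and ray `i + 1`: corner `0` is north, `1` west, `2` south, `3` east.
So the corners `0` and `1` are on the left of the over-strand and `2` and `3` on its right. -/

/-- The rays at crossings as ends of strands: `((c, o), out)` with `o = true` for the over-strand,
and `out = true` for the end by which the strand leaves the crossing. The under-strand runs from
south-east to north-west at a positive crossing, and the other way at a negative one. -/
def rayEquiv : (X × Bool) × Bool ≃ X × Fin 4 where
  toFun
    | ((c, true), true) => (c, 0)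
    | ((c, true), false) => (c, 2)
    | ((c, false), out) => (c, if out = D.positive c then 1 else 3)
  invFun
    | (c, 0) => ((c, true), true)
    | (c, 1) => ((c, false), D.positive c)
    | (c, 2) => ((c, true), false)
    | (c, 3) => ((c, false), !D.positive c)
  left_inv := by
    rintro ⟨⟨c, _ | _⟩, _ | _⟩ <;> cases h : D.positive c <;> simp [h]
  right_inv := by
    rintro ⟨c, i⟩
    fin_cases i <;> cases h : D.positive c <;> simp [h]

/-- The two ends of each edge are exchanged: the edge that leaves `p` arrives at `next p`. -/
def swapEnds : Equiv.Perm ((X × Bool) × Bool) where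
  toFun
    | (p, true) => (D.next p, false)
    | (p, false) => (D.next.symm p, true)
  invFun
    | (p, true) => (D.next p, false)
    | (p, false) => (D.next.symm p, true)
  left_inv := by rintro ⟨p, _ | _⟩ <;> simp
  right_inv := by rintro ⟨p, _ | _⟩ <;> simp

/-- The ray at the other end of the same edge. -/
def oppositeRay : Equiv.Perm (X × Fin 4) :=
  (D.rayEquiv.symm.trans D.swapEnds).trans D.rayEquiv

/-- The left-hand side of the ray `r`, seen by someone who looks outward from the crossing, as a
side of an oriented edge. -/
def outwardLeft (r : X × Fin 4) : D.Edge × EdgeSide :=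
  match D.rayEquiv.symm r with
  | (p, true) => (Edge.leaving p, EdgeSide.left)
  | (p, false) => (Edge.leaving (D.next.symm p), EdgeSide.right)

/-- The right-hand side of the ray `r`, seen by someone who looks outward from the crossing. -/
def outwardRight (r : X × Fin 4) : D.Edge × EdgeSide :=
  match D.rayEquiv.symm r with
  | (p, true) => (Edge.leaving p, EdgeSide.right)
  | (p, false) => (Edge.leaving (D.next.symm p), EdgeSide.left)

/-- The faces: at every crossing the left-hand side of ray `i` and the right-hand side of ray
`i + 1` belong to one face (it has a corner there), and these identifications generate all. -/
def Face : Type _ :=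
  Quot fun s s' : D.Edge × EdgeSide =>
    ∃ (c : X) (i : Fin 4), s = D.outwardLeft (c, i) ∧ s' = D.outwardRight (c, i + 1)

/-- The face on the given side of an edge. -/
def faceAt (e : D.Edge) (s : EdgeSide) : D.Face := Quot.mk _ (e, s)

/-- The face in which a corner lies. -/
def cornerFace (k : X × Fin 4) : D.Face := Quot.mk _ (D.outwardLeft k)

/-- Two faces are adjacent if they are the two sides of some edge. -/
def Adjacent (f g : D.Face) : Prop :=
  ∃ e : D.Edge, (f = D.faceAt e .left ∧ g = D.faceAt e .right) ∨
    (f = D.faceAt e .right ∧ g = D.faceAt e .left)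

end GaussCode

/-- A knot diagram on the sphere, with crossing set `X`: a signed Gauss code of genus `0`. As there
are twice as many edges as crossings, Euler's formula says that there are two more faces than
crossings (this is also right for the diagram without crossings). -/
structure KnotDiagram (X : Type*) extends GaussCode X where
  planar : Nat.card toGaussCode.Face = Nat.card X + 2

namespace KnotDiagram

variable {X : Type*} (D : KnotDiagram X)

/-- The faces of the diagram. -/
abbrev Face : Type _ := D.toGaussCode.Face

/-! ### The Dehn presentation and the Alexander polynomial -/

section Alexander

variable (a₀ : D.Face)

open Classical in
/-- The element of the free group on the faces other than the unbounded face `a₀` that belongs to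
a face: the generator `A_y`, and `1` for `a₀`. -/
noncomputable def gen (y : D.Face) : FreeGroup {y : D.Face // y ≠ a₀} :=
  if h : y = a₀ then 1 else FreeGroup.of ⟨y, h⟩

/-- The Dehn relator `A₄ A₂⁻¹ (A₃ A₁⁻¹)⁻¹` at a crossing, where `a₁`, `a₂`, `a₃`, `a₄` are the faces
to the north, west, east and south when the over-strand runs to the north-east. -/
noncomputable def dehnRelator (c : X) : FreeGroup {y : D.Face // y ≠ a₀} :=
  let A₁ := D.gen a₀ (D.cornerFace (c, 0))
  let A₂ := D.gen a₀ (D.cornerFace (c, 1))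
  let A₃ := D.gen a₀ (D.cornerFace (c, 3))
  let A₄ := D.gen a₀ (D.cornerFace (c, 2))
  A₄ * A₂⁻¹ * (A₃ * A₁⁻¹)⁻¹

/-- The knot group, given by the Dehn presentation. The generator `A_y` is the loop that goes down
through the face `y` and returns through `a₀` to the base point above the plane. -/
abbrev KnotGroup : Type _ := PresentedGroup (Set.range (D.dehnRelator a₀))

/-- The projection from the free group to the knot group. -/
def toKnotGroup : FreeGroup {y : D.Face // y ≠ a₀} →* D.KnotGroup a₀ :=
  PresentedGroup.mk _

/-- The meridian that goes down on the right of an edge and returns on its left, and so links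
the knot positively. -/
noncomputable def meridian (e : D.Edge) : D.KnotGroup a₀ :=
  D.toKnotGroup a₀ (D.gen a₀ (D.faceAt e .right) * (D.gen a₀ (D.faceAt e .left))⁻¹)

/-- `ψ` is the abelianization map from the knot group to the infinite cyclic group, normalized so
that it takes every positive meridian to the generator `t`. -/
def IsAbelianizationMap (ψ : D.KnotGroup a₀ →* Multiplicative ℤ) : Prop :=
  ∀ e : D.Edge, ψ (D.meridian a₀ e) = Multiplicative.ofAdd 1

/-- The ring homomorphism `ℤ[F] → ℤ[π] → ℤ[t, t⁻¹]`, where `F` is the free group and `π` the knot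
group: the projection followed by the linear extension of `ψ`. -/
noncomputable def groupRingMap (ψ : D.KnotGroup a₀ →* Multiplicative ℤ) :
    MonoidAlgebra ℤ (FreeGroup {y : D.Face // y ≠ a₀}) →+* ℤ[T;T⁻¹] :=
  (MonoidAlgebra.lift ℤ ℤ[T;T⁻¹] (D.KnotGroup a₀)
      ((AddMonoidAlgebra.of ℤ ℤ).comp ψ)).toRingHom.comp
    (MonoidAlgebra.mapDomainRingHom ℤ (D.toKnotGroup a₀))

/-- The matrix of the free derivatives of the Dehn relators, with one row for each crossing and one
column for each face other than `a₀`. -/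
noncomputable def foxMatrix (ψ : D.KnotGroup a₀ →* Multiplicative ℤ) :
    Matrix X {y : D.Face // y ≠ a₀} ℤ[T;T⁻¹] :=
  Matrix.of fun c y => D.groupRingMap a₀ ψ (foxDeriv y (D.dehnRelator a₀ c))

end Alexander

/-- Equality up to multiplication with `± t ^ k` for some `k`. -/
def DotEq (p q : ℤ[T;T⁻¹]) : Prop :=
  ∃ k : ℤ, p = LaurentPolynomial.T k * q ∨ p = -(LaurentPolynomial.T k * q)

/-- `Δ` is an Alexander polynomial of the knot with diagram `D`, whose unbounded face is `a₀`:
up to `± t ^ k` it is the determinant of the matrix of free derivatives from which the column of a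
face `b` adjacent to `a₀` is deleted. Here `e` is a numbering of the remaining columns by the rows,
which makes the matrix square. -/
def IsAlexanderPolynomial [Fintype X] [DecidableEq X] (a₀ : D.Face) (Δ : ℤ[T;T⁻¹]) : Prop :=
  ∃ ψ : D.KnotGroup a₀ →* Multiplicative ℤ, D.IsAbelianizationMap a₀ ψ ∧
    ∃ b : D.Face, D.Adjacent a₀ b ∧
      ∃ e : X ≃ {y : {y : D.Face // y ≠ a₀} // y.1 ≠ b},
        DotEq Δ ((D.foxMatrix a₀ ψ).submatrix id fun c => (e c).1).det

/-! ### The Alexander graph -/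

section AlexanderGraph

variable (f g : D.Face)

/-- The faces that remain when `f` and `g` are disregarded. -/
abbrev RemainingFace : Type _ := {y : D.Face // y ≠ f ∧ y ≠ g}

/-- The edges of the Alexander graph: the incidences of crossings with remaining faces, that is,
the corners of the diagram in these faces. -/
def GraphEdge : Type _ := {k : X × Fin 4 // D.cornerFace k ≠ f ∧ D.cornerFace k ≠ g}

noncomputable instance [Fintype X] : Fintype (D.GraphEdge f g) :=
  have : Finite (D.GraphEdge f g) := Subtype.finite
  Fintype.ofFinite _

/-- The Alexander graph: crossings versus faces other than `f` and `g`, with an edge for each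
incidence. -/
def alexanderGraph : BipartiteGraph X (D.RemainingFace f g) (D.GraphEdge f g) where
  end₁ k := k.1.1
  end₂ k := ⟨D.cornerFace k.1, k.2⟩

/-- The local weights `t`, `t`, `1`, `1`: `t` on the left of the over-strand, `1` on its right. -/
noncomputable def cornerWeight (k : X × Fin 4) : ℤ[T;T⁻¹] :=
  if k.2 = 0 ∨ k.2 = 1 then LaurentPolynomial.T 1 else 1

/-- The weighting of the Alexander graph by the local weights. -/
noncomputable def alpha (k : D.GraphEdge f g) : ℤ[T;T⁻¹] := cornerWeight k.1

end AlexanderGraph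

/-! ### Kasteleyn weightings

Draw a vertex in each face of the diagram and join it to the crossing at each corner of the face.
This is a graph on the sphere, and the Alexander graph arises from it when the vertices `f` and `g`
are deleted. Thereby all faces of this graph incident with `f` or `g` merge into one (the edge
of the diagram between `f` and `g` runs in a face incident with both) and the other faces stay as
they are. With the point at infinity in `f`, the merged face is the unbounded one. -/

/-- The next corner, counterclockwise, around the same crossing. -/
def nextAtCrossing : Equiv.Perm (X × Fin 4) :=
  Equiv.prodCongr (Equiv.refl X) (Equiv.addRight (1 : Fin 4))

/-- The next corner, counterclockwise, around the same face: from corner `i` walk outward along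
ray `i`, with the face on the left-hand side, to the crossing at the other end of that edge. The
corner that is then on the left is the one just before the ray by which the walk arrives. -/
def nextAtFace : Equiv.Perm (X × Fin 4) :=
  D.oppositeRay.trans nextAtCrossing.symm

/-- Two consecutive steps along the boundary of a face of the graph of all corners: come to the
face vertex along the edge `k`, turn to the next edge there, go along it to its crossing,
and turn to the next edge there. -/
def boundaryStep : Equiv.Perm (X × Fin 4) :=
  D.nextAtFace.trans nextAtCrossing

/-- The edges on the boundary of the face of the graph of all corners that has the edge `k` on its
boundary, on the proper side, in order and with multiplicity. -/
noncomputable def boundaryWalk (k : X × Fin 4) : List (X × Fin 4) :=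
  (List.range (Function.minimalPeriod D.boundaryStep k)).flatMap fun i =>
    [D.boundaryStep^[i] k, D.nextAtFace (D.boundaryStep^[i] k)]

/-- `w` is the closed walk along the boundary of a bounded face of the Alexander graph: a
face of the graph of all corners that is not incident with `f` or `g`. -/
def IsBoundedFaceWalk (f g : D.Face) (w : List (D.GraphEdge f g)) : Prop :=
  ∃ k : X × Fin 4, w.map Subtype.val = D.boundaryWalk k

/-- A Kasteleyn weighting of the Alexander graph: each bounded face with `0` mod `4` edges has
an odd number of `-1` assignments, each bounded face with `2` mod `4` edges an even number. -/
def IsKasteleyn {f g : D.Face} (ε : D.GraphEdge f g → ℤˣ) : Prop :=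
  ∀ w : List (D.GraphEdge f g), D.IsBoundedFaceWalk f g w →
    (w.length % 4 = 0 → Odd ((w.map ε).count (-1))) ∧
    (w.length % 4 = 2 → Even ((w.map ε).count (-1)))

/-! ### Kauffman's weighting and Kauffman's state sum -/

/-- Kauffman's weights: `-1` at the corner between the two outgoing ends of the strands
(north at a positive crossing, east at a negative one), and `1` at the other corners. -/
def kauffmanSign (k : X × Fin 4) : ℤˣ :=
  if k.2 = (if D.positive k.1 then 0 else 3) then -1 else 1

/-- Kauffman's weights as a weighting of the Alexander graph. -/
def kauffmanWeighting (f g : D.Face) (k : D.GraphEdge f g) : ℤˣ := D.kauffmanSign k.1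

/-- A state: a marker at one corner `s c` of each crossing `c`, none of them in `f` or `g`, such that
each other face has exactly one marker. -/
def IsState (f g : D.Face) (s : X → Fin 4) : Prop :=
  (∀ c, D.cornerFace (c, s c) ≠ f ∧ D.cornerFace (c, s c) ≠ g) ∧
    ∀ y : D.Face, y ≠ f → y ≠ g → ∃! c, D.cornerFace (c, s c) = y

open Classical in
/-- Kauffman's state sum: the sum over all states of the product of the weights at the markers, each
the product of the local weight and Kauffman's sign. -/
noncomputable def kauffmanStateSum [Fintype X] (f g : D.Face) : ℤ[T;T⁻¹] :=
  ∑ s : X → Fin 4 with D.IsState f g s,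
    ∏ c, (((D.kauffmanSign (c, s c) : ℤ) : ℤ[T;T⁻¹]) * cornerWeight (c, s c))

/-- The partition function of the Alexander graph, weighted with the product of the local weights
and the signs `ε`. -/
noncomputable def dimerStateSum [Fintype X] {f g : D.Face} (ε : D.GraphEdge f g → ℤˣ) : ℤ[T;T⁻¹] :=
  (D.alexanderGraph f g).partitionFunction fun k => ((ε k : ℤ) : ℤ[T;T⁻¹]) * D.alpha f g k

end KnotDiagram

set_option linter.unusedSectionVars false

/-! ### Signs of permutations and cuts through their cycles -/

/-! Fox calculus turns the Dehn relator of a crossing into a row of Alexander's matrix, with t, -t,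
1, -1 at the north, west, south and east corners (`foxMatrix_eq`). A numbering z of the faces that
grows by one across each edge from left to right then does three jobs. It gives the abelianization
map A_y ↦ t^(z y - z a₀). It gives two relations between the columns: they sum to zero, both as they
are and weighted with t^(z y). So minors that omit the pairs (a, b) and (f, g) are proportional,
with factors t^(z b) - t^(z a) and t^(z g) - t^(z f); for adjacent faces these are ±t^k (t - 1), and
t - 1 cancels (`dotEq_det_alexanderMatrix`). Finally its parity alternates around each crossing, so
that signs on rows and columns reduce the matrix to the plain weights t, t, 1, 1
(`det_alexanderMatrix_submatrix`).

A minor of the weight matrix is a sum over states, each signed by a permutation. Kasteleyn signs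
reproduce these signs up to a common factor (`StatePair.sign_perm_eq`). Indeed the markers of two
states form a cycle mod 2 in the graph of all corners, whose faces are quadrilaterals, one for each
edge of the diagram. On the sphere the cycle bounds a set T of edges, chosen to omit an edge between
f and g. Multiplying the Kasteleyn conditions over T shows that the product of the signs at all
markers is (-1)^|T|.

The relative permutation of the two states has the same sign by a count of cycles. Let σ and φ
rotate the corners around crossings and faces, let α = σφ exchange the ends of edges, and let τ and
υ exchange the two markers at each crossing and in each face. On the rays of T, τσ⁻¹ has one cycle
for each crossing that T touches and υφ one for each face, and both numbers equal the number of
markers in T. As υφ = (υτ)(τσ⁻¹)α, the sign of υτ on T is that of α, namely (-1)^|T|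
(`sign_subtypePerm_mul_of_cutsCycles`).

Planarity enters through dimension counts (`Matrix.exists_mulVec_eq_of_card`): over ℚ they yield the
numbering, over 𝔽₂ the set T. -/

theorem Finset.card_image_le_of_imp {α β γ : Type*} [DecidableEq β] [DecidableEq γ] {s : Finset α}
    {f : α → β} {g : α → γ} (h : ∀ a ∈ s, ∀ b ∈ s, g a = g b → f a = f b) :
    (s.image f).card ≤ (s.image g).card := by
  rcases s.eq_empty_or_nonempty with rfl | ⟨a₀, -⟩
  · simp
  have : Nonempty α := ⟨a₀⟩
  choose! i hi using fun (c : γ) (hc : c ∈ s.image g) => Finset.mem_image.1 hc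
  refine (Finset.card_le_card (t := (s.image g).image (f ∘ i)) ?_).trans Finset.card_image_le
  intro y hy
  obtain ⟨k, hk, rfl⟩ := Finset.mem_image.1 hy
  have h6 := Finset.mem_image_of_mem g hk
  exact Finset.mem_image.2 ⟨_, h6, h _ (hi _ h6).1 _ hk (hi _ h6).2⟩

theorem Finset.card_image_congr_of_iff {α β γ : Type*} [DecidableEq β] [DecidableEq γ]
    {s : Finset α} {f : α → β} {g : α → γ} (h : ∀ a ∈ s, ∀ b ∈ s, f a = f b ↔ g a = g b) :
    (s.image f).card = (s.image g).card :=
  le_antisymm (card_image_le_of_imp fun a ha b hb => (h a ha b hb).2)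
    (card_image_le_of_imp fun a ha b hb => (h a ha b hb).1)

namespace Equiv.Perm

variable {Ω Y : Type*} [Fintype Ω] [DecidableEq Ω]

/-- A cycle of length l has sign (-1)^(l+1), also for l = 1. The fibres of `q` are the cycles, fixed
points included, so its image counts them. -/
theorem sign_eq_neg_one_pow_card_add_card_image [DecidableEq Y] (ρ : Perm Ω) (q : Ω → Y)
    (hq : ∀ k k', q k = q k' ↔ ρ.SameCycle k k') :
    sign ρ = (-1) ^ (Fintype.card Ω + (Finset.univ.image q).card) := by
  have h1 : (Finset.univ.image q) = (ρ.support.image q) ∪ (ρ.supportᶜ.image q) := by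
    rw [← Finset.image_union, Finset.union_compl]
  have h2 : _root_.Disjoint (ρ.support.image q) (ρ.supportᶜ.image q) := by
    rw [Finset.disjoint_left]
    intro y hy hy'
    obtain ⟨k, hk, rfl⟩ := Finset.mem_image.1 hy
    obtain ⟨k', hk', h⟩ := Finset.mem_image.1 hy'
    have := (hq k' k).1 h
    rw [Finset.mem_compl, mem_support, not_not] at hk'
    have h3 := SameCycle.eq_of_left this hk'
    subst h3
    exact (mem_support.1 hk) hk'
  have h3 : (ρ.supportᶜ.image q).card = ρ.supportᶜ.card := by
    apply Finset.card_image_of_injOn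
    intro k hk k' _ h
    rw [Finset.mem_coe, Finset.mem_compl, mem_support, not_not] at hk
    exact SameCycle.eq_of_left ((hq k k').1 h) hk
  have h4 : (ρ.support.image q).card = ρ.cycleFactorsFinset.card := by
    have h5 : ρ.cycleFactorsFinset = ρ.support.image ρ.cycleOf := by
      ext c
      rw [Finset.mem_image]
      constructor
      · intro hc
        obtain ⟨x, hx⟩ := (mem_cycleFactorsFinset_iff.1 hc).1.nonempty_support
        exact ⟨x, mem_cycleFactorsFinset_support_le hc hx,
          ((eq_cycleOf_of_mem_cycleFactorsFinset_iff ρ c hc x).2 hx).symm⟩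
      · rintro ⟨x, hx, rfl⟩
        exact cycleOf_mem_cycleFactorsFinset_iff.2 hx
    have key : ∀ k ∈ ρ.support, ∀ k' ∈ ρ.support, q k = q k' ↔ ρ.cycleOf k = ρ.cycleOf k' := by
      intro k hk k' hk'
      rw [hq]
      refine ⟨fun h => h.cycleOf_eq, fun h => ?_⟩
      have : k ∈ (ρ.cycleOf k').support := by
        rw [← h, mem_support_cycleOf_iff]
        exact ⟨SameCycle.refl _ _, hk⟩
      exact (mem_support_cycleOf_iff.1 this).1.symm
    rw [h5]
    exact Finset.card_image_congr_of_iff key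
  rw [sign_of_cycleType, sum_cycleType, cycleType_def, Multiset.card_map, h1,
    Finset.card_union_of_disjoint h2, h3, h4, ← Finset.card_add_card_compl ρ.support]
  have : ρ.cycleFactorsFinset.1.card = ρ.cycleFactorsFinset.card := rfl
  rw [this, show ρ.support.card + ρ.supportᶜ.card +
    (ρ.cycleFactorsFinset.card + ρ.supportᶜ.card) = ρ.support.card + ρ.cycleFactorsFinset.card
      + 2 * ρ.supportᶜ.card by ring, pow_add _ _ (2 * _), pow_mul]
  simp

theorem sign_subtypePerm_eq_neg_one_pow [DecidableEq Y] (ρ : Perm Ω) (T : Finset Ω)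
    (h : ∀ k, ρ k ∈ T ↔ k ∈ T) (q : Ω → Y)
    (hq : ∀ k ∈ T, ∀ k' ∈ T, q k = q k' ↔ ρ.SameCycle k k') :
    sign (ρ.subtypePerm h) = (-1) ^ (T.card + (T.image q).card) := by
  rw [sign_eq_neg_one_pow_card_add_card_image (ρ.subtypePerm h) (fun k => q k)]
  · congr 2
    · simp
    · congr 1
      ext y
      simp
  · intro k k'
    rw [sameCycle_subtypePerm]
    exact hq k k.2 k' k'.2

/-- The involution `τ` moves at most two of the elements of each cycle of `ρ` (the cycles being the
fibres of `P`), and `T` is a union of arcs into which the cycles are cut at the moved elements.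
The elements of `W` are the moved ones and at most one mark on cycles without moved ones. -/
structure CutsCycles (ρ τ : Perm Ω) (P : Ω → Y) (W T : Finset Ω) : Prop where
  fiber : ∀ k k', P k = P k' ↔ ρ.SameCycle k k'
  invol : ∀ k, τ (τ k) = k
  mark : ∀ w ∈ W, ∀ w' ∈ W, P w = P w' → w' = w ∨ w' = τ w
  moved : ∀ k, τ k ≠ k → k ∈ W
  map : ∀ k, P (τ k) = P k
  cut : ∀ k, (k ∈ T ↔ ρ k ∈ T) ↔ τ (ρ k) = ρ k

namespace CutsCycles

variable {ρ τ : Perm Ω} {P : Ω → Y} {W T : Finset Ω} (h : CutsCycles ρ τ P W T)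
include h

theorem map_apply (k : Ω) : P (ρ k) = P k :=
  (h.fiber _ _).2 (sameCycle_apply_left.2 (SameCycle.refl _ _))

theorem fiber_induction (S : Ω → Prop) {k : Ω} (hk : S k)
    (hS : ∀ j, P j = P k → S j → S (ρ j)) {k' : Ω} (hP : P k = P k') : S k' := by
  obtain ⟨i, -, rfl⟩ := ((h.fiber _ _).1 hP).exists_pow_eq'
  clear hP
  have : P ((ρ ^ i) k) = P k ∧ S ((ρ ^ i) k) := by
    induction i with
    | zero => exact ⟨rfl, hk⟩
    | succ i ih =>
      rw [pow_succ', mul_apply]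
      exact ⟨(h.map_apply _).trans ih.1, hS _ ih.1 ih.2⟩
  exact this.2

/-- Membership in `T` flips exactly on arrival at a moved element, and a cycle has at most two of
these, `k` and `τ k`. If both were on the same side of `T`, membership would be constant along the
cycle from `k` round to its predecessor, and there would be no flip at `k`. -/
theorem invol_mem {k : Ω} (hk : τ k ≠ k) : τ k ∈ T ↔ k ∉ T := by
  by_contra hc
  have hc' : τ k ∈ T ↔ k ∈ T := by tauto
  have hP : P (ρ.symm k) = P k := by
    have := h.map_apply (ρ.symm k)
    rw [Equiv.apply_symm_apply] at this
    exact this.symm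
  have := h.fiber_induction (fun j => j ∈ T ↔ k ∈ T) (k := k) Iff.rfl (fun j hj hS => by
    by_cases hτ : τ (ρ j) = ρ j
    · rw [← (h.cut j).2 hτ]
      exact hS
    · rcases h.mark k (h.moved _ hk) (ρ j) (h.moved _ hτ) ((h.map_apply j).trans hj).symm with
        h1 | h1
      · rw [h1]
      · rw [h1]
        exact hc') hP.symm
  have h2 := h.cut (ρ.symm k)
  rw [Equiv.apply_symm_apply] at h2
  exact hk (h2.1 this)

theorem mul_mem (k : Ω) : (τ * ρ) k ∈ T ↔ k ∈ T := by
  rw [mul_apply]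
  by_cases hτ : τ (ρ k) = ρ k
  · rw [hτ, (h.cut k).2 hτ]
  · have h1 := h.invol_mem hτ
    have h2 := (h.cut k).not.2 hτ
    tauto

/-- Within one cycle of `ρ` the set `T` is a single arc, or everything. Along the arc `τ * ρ` agrees
with `ρ`; behind its last element `ρ` reaches the moved element outside of `T`, which `τ` sends back
to the start of the arc. -/
theorem sameCycle_mul_iff {k k' : Ω} (hk : k ∈ T) (hk' : k' ∈ T) :
    P k = P k' ↔ (τ * ρ).SameCycle k k' := by
  constructor
  · intro hP
    -- `a` is the start of the arc: the moved element that lies in `T`, or just `k` if the cycle has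
    -- no moved elements.
    obtain ⟨a, haT, ha, hb⟩ : ∃ a ∈ T, P a = P k ∧ ∀ j ∈ T, P j = P k → j ≠ a → τ j = j := by
      by_cases hj : ∃ j, P j = P k ∧ τ j ≠ j
      · obtain ⟨j, hj, hτ⟩ := hj
        have h1 := h.invol_mem hτ
        by_cases hjT : j ∈ T
        · refine ⟨j, hjT, hj, fun i hi hiP hij => ?_⟩
          by_contra hτi
          rcases h.mark j (h.moved _ hτ) i (h.moved _ hτi) (hj.trans hiP.symm) with h2 | h2
          · exact hij h2
          · rw [h2] at hi
            exact h1.1 hi hjT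
        · refine ⟨τ j, h1.2 hjT, (h.map _).trans hj, fun i hi hiP hij => ?_⟩
          by_contra hτi
          rcases h.mark j (h.moved _ hτ) i (h.moved _ hτi) (hj.trans hiP.symm) with h2 | h2
          · rw [h2] at hi
            exact hjT hi
          · exact hij h2
      · push Not at hj
        exact ⟨k, hk, rfl, fun j _ hjP _ => hj j hjP⟩
    have key : ∀ j, P a = P j → j ∈ T → (τ * ρ).SameCycle a j := fun j hj =>
      h.fiber_induction (fun j => j ∈ T → (τ * ρ).SameCycle a j) (fun _ => SameCycle.refl _ _)
        (fun j hj hS hjT => by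
          by_cases hja : ρ j = a
          · rw [hja]
          · have h1 := hb _ hjT ((h.map_apply j).trans (hj.trans ha)) hja
            have h2 := hS (((h.cut j).2 h1).2 hjT)
            rw [← sameCycle_apply_right, mul_apply, h1] at h2
            exact h2) hj
    exact (key k ha hk).symm.trans (key k' (ha.trans hP) hk')
  · intro hs
    obtain ⟨i, -, rfl⟩ := hs.exists_pow_eq'
    clear hs hk'
    induction i with
    | zero => rfl
    | succ i ih => rw [pow_succ', mul_apply, mul_apply, h.map, h.map_apply, ih]

theorem sign_subtypePerm_mul [DecidableEq Y] :
    sign ((τ * ρ).subtypePerm h.mul_mem) = (-1) ^ (T.card + (T.image P).card) :=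
  sign_subtypePerm_eq_neg_one_pow _ _ _ _ fun _ hk _ hk' => h.sameCycle_mul_iff hk hk'

/-- Each cycle that meets `T` has exactly one mark in `T`: of two exchanged marks one is in `T` by
`invol_mem`, and around an unmoved mark the whole cycle lies in `T`. -/
theorem card_image_eq [DecidableEq Y] (hT : ∀ k ∈ T, ∃ w ∈ W, P w = P k) :
    (T.image P).card = (T ∩ W).card := by
  have h1 : T.image P = (T ∩ W).image P := by
    apply Finset.Subset.antisymm
    · intro y hy
      obtain ⟨k, hk, rfl⟩ := Finset.mem_image.1 hy
      obtain ⟨w, hw, hwk⟩ := hT k hk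
      rw [Finset.mem_image]
      simp only [Finset.mem_inter]
      by_cases hm : τ w = w
      · refine ⟨w, ⟨?_, hw⟩, hwk⟩
        exact h.fiber_induction (fun j => j ∈ T) hk (fun j hj hjT => by
          have h2 : τ (ρ j) = ρ j := by
            by_contra h2
            rcases h.mark w hw (ρ j) (h.moved _ h2)
              (hwk.trans (hj.symm.trans (h.map_apply j).symm)) with h3 | h3
            · rw [h3] at h2
              exact h2 hm
            · rw [h3, hm] at h2
              exact h2 hm
          exact ((h.cut j).2 h2).1 hjT) hwk.symm
      · by_cases hwT : w ∈ T
        · exact ⟨w, ⟨hwT, hw⟩, hwk⟩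
        · refine ⟨τ w, ⟨(h.invol_mem hm).2 hwT, h.moved _ ?_⟩, (h.map w).trans hwk⟩
          rw [h.invol]
          exact fun h' => hm h'.symm
    · exact Finset.image_subset_image Finset.inter_subset_left
  rw [h1]
  apply Finset.card_image_of_injOn
  intro w hw w' hw' hP
  simp only [Finset.coe_inter, Set.mem_inter_iff, Finset.mem_coe] at hw hw'
  rcases h.mark w hw.2 w' hw'.2 hP with h1 | h1
  · exact h1.symm
  · by_cases hm : τ w = w
    · rw [h1, hm]
    · have := (h.invol_mem hm).1 (h1 ▸ hw'.1)
      exact absurd hw.1 this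

end CutsCycles

/-- The permutation that agrees with `ρ` on an invariant set and is the identity elsewhere. -/
def restrict (ρ : Perm Ω) (T : Finset Ω) (h : ∀ k, ρ k ∈ T ↔ k ∈ T) : Perm Ω :=
  ofSubtype (ρ.subtypePerm h)

theorem restrict_apply (ρ : Perm Ω) (T : Finset Ω) (h : ∀ k, ρ k ∈ T ↔ k ∈ T) (k : Ω) :
    ρ.restrict T h k = if k ∈ T then ρ k else k := by
  split_ifs with hk
  · exact ofSubtype_apply_of_mem _ hk
  · exact ofSubtype_apply_of_not_mem _ hk

theorem sign_restrict (ρ : Perm Ω) (T : Finset Ω) (h : ∀ k, ρ k ∈ T ↔ k ∈ T) :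
    sign (ρ.restrict T h) = sign (ρ.subtypePerm h) :=
  sign_ofSubtype _

/-- If two involutions with the same moved points move elements of `m` out of `m` and the other way,
then the sign of the restriction of their product to `m` does not depend on `m`. -/
theorem sign_subtypePerm_involutions_eq (τ υ : Perm Ω) (hτ : ∀ k, τ (τ k) = k)
    (hυ : ∀ k, υ (υ k) = k) (hm : ∀ k, τ k = k ↔ υ k = k) (m T : Finset Ω)
    (hmτ : ∀ k, τ k ≠ k → (τ k ∈ m ↔ k ∉ m))
    (hTτ : ∀ k, τ k ≠ k → (τ k ∈ T ↔ k ∉ T))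
    (h1 : ∀ k, (υ * τ) k ∈ m ↔ k ∈ m) (h2 : ∀ k, (υ * τ) k ∈ T ↔ k ∈ T) :
    sign ((υ * τ).subtypePerm h1) = sign ((υ * τ).subtypePerm h2) := by
  classical
  have hτk : ∀ k, τ k ≠ k → τ (τ k) ≠ τ k := fun k hk => by rw [hτ]; exact hk.symm
  have hυk : ∀ k, τ k ≠ k → υ (τ k) ≠ τ k := fun k hk => (hm _).not.1 (hτk k hk)
  have e1 : ∀ k, (υ * τ) k ∈ m ∩ T ↔ k ∈ m ∩ T := fun k => by
    rw [Finset.mem_inter, Finset.mem_inter, h1, h2]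
  have e2 : ∀ k, (υ * τ) k ∈ m \ T ↔ k ∈ m \ T := fun k => by
    rw [Finset.mem_sdiff, Finset.mem_sdiff, h1, h2]
  have e3 : ∀ k, (υ * τ) k ∈ T \ m ↔ k ∈ T \ m := fun k => by
    rw [Finset.mem_sdiff, Finset.mem_sdiff, h1, h2]
  have f1 : (υ * τ).restrict m h1 = (υ * τ).restrict _ e1 * (υ * τ).restrict _ e2 := by
    ext k
    simp only [mul_apply (restrict _ _ _), restrict_apply]
    by_cases hk : k ∈ m <;> by_cases hk' : k ∈ T <;> simp [hk, hk']
    intro h3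
    have := h2 k
    simp only [mul_apply] at this
    tauto
  have f2 : (υ * τ).restrict T h2 = (υ * τ).restrict _ e1 * (υ * τ).restrict _ e3 := by
    ext k
    simp only [mul_apply (restrict _ _ _), restrict_apply]
    by_cases hk : k ∈ m <;> by_cases hk' : k ∈ T <;> simp [hk, hk']
    intro h3
    have := h1 k
    simp only [mul_apply] at this
    tauto
  -- `τ` exchanges the moved elements of `m \ T` and `T \ m`, and conjugation with `τ` inverts `υ *
  -- τ`.
  have f3 : (υ * τ).restrict _ e3 = τ * ((υ * τ).restrict _ e2)⁻¹ * τ⁻¹ := by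
    rw [eq_mul_inv_iff_mul_eq, eq_mul_inv_iff_mul_eq]
    ext k
    simp only [mul_apply (restrict _ _ _), mul_apply (_ * _), restrict_apply]
    by_cases hk : τ k = k
    · have hk' : υ k = k := (hm k).1 hk
      have hk2 : (υ * τ) k = k := by rw [mul_apply, hk, hk']
      simp [hk, hk']
    · have g1 := hmτ k hk
      have g2 := hTτ k hk
      have g3 := e2 k
      have g4 := hmτ (υ (τ k)) ((hm _).not.2 (by rw [hυ]; exact (hυk k hk).symm))
      have g5 := hTτ (υ (τ k)) ((hm _).not.2 (by rw [hυ]; exact (hυk k hk).symm))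
      have g6 := h1 k
      have g7 := h2 k
      simp only [mul_apply] at g6 g7
      by_cases hk1 : k ∈ m <;> by_cases hk2 : k ∈ T <;>
        simp_all
  rw [← sign_restrict, ← sign_restrict, f1, f2, f3]
  rw [sign_mul, sign_mul, sign_mul, sign_mul, sign_inv, sign_inv, mul_right_comm,
    Int.units_mul_self, one_mul]

/-- The sign of the product of two involutions that cut the vertex cycles `σ` and the face cycles
`φ` of a map into arcs belonging to one set `T` of edges. -/
theorem sign_subtypePerm_mul_of_cutsCycles {Z : Type*} {σ φ α τ υ : Perm Ω} {p : Ω → Y} {q : Ω → Z}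
    {W T : Finset Ω} (hα : α = σ * φ) (hαT : ∀ k, α k ∈ T ↔ k ∈ T)
    (hp : CutsCycles σ⁻¹ τ p W T) (hq : CutsCycles φ υ q W T)
    (hpT : ∀ k ∈ T, ∃ w ∈ W, p w = p k) (hqT : ∀ k ∈ T, ∃ w ∈ W, q w = q k)
    (hT : ∀ k, (υ * τ) k ∈ T ↔ k ∈ T) :
    sign ((υ * τ).subtypePerm hT) = sign (α.subtypePerm hαT) := by
  classical
  have hττ : τ * τ = 1 := ext hp.invol
  have h1 : υ * φ = (υ * τ) * (τ * σ⁻¹) * α := by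
    rw [hα, mul_assoc, mul_assoc, mul_assoc, ← mul_assoc τ τ, hττ, one_mul, inv_mul_cancel_left]
  have h2 : (υ * φ).subtypePerm hq.mul_mem =
      (υ * τ).subtypePerm hT * (τ * σ⁻¹).subtypePerm hp.mul_mem * α.subtypePerm hαT :=
    ext fun k => Subtype.ext (congrArg (fun ρ : Perm Ω => ρ k) h1)
  have h3 := congrArg sign h2
  -- The signs of `υ * φ` and `τ * σ⁻¹` on `T` coincide, since both numbers of cycles are `(T ∩
  -- W).card`. They cancel, which leaves sign(υτ) · sign(α) = 1.
  rw [sign_mul, sign_mul, hq.sign_subtypePerm_mul, hp.sign_subtypePerm_mul, hp.card_image_eq hpT,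
    hq.card_image_eq hqT, mul_right_comm, eq_comm, mul_eq_right] at h3
  rw [eq_inv_of_mul_eq_one_left h3, Int.units_inv_eq_self]

end Equiv.Perm

/-! ### Exactness by counting dimensions -/

namespace Matrix

variable {K m n k : Type*} [Field K] [Fintype n]

theorem finrank_ker_mulVecLin_le_one (B : Matrix m n K)
    (hB : ∀ v, B *ᵥ v = 0 → ∀ i j, v i = v j) :
    Module.finrank K (LinearMap.ker B.mulVecLin) ≤ 1 := by
  have h : LinearMap.ker B.mulVecLin ≤ Submodule.span K {(fun _ => 1 : n → K)} := by
    intro v hv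
    rw [LinearMap.mem_ker, mulVecLin_apply] at hv
    rw [Submodule.mem_span_singleton]
    rcases isEmpty_or_nonempty n with hn | ⟨⟨i⟩⟩
    · exact ⟨0, Subsingleton.elim _ _⟩
    · exact ⟨v i, funext fun j => by simpa using hB v hv i j⟩
  exact (Submodule.finrank_mono h).trans ((finrank_span_le_card _).trans (by simp))

/-- A complex of matrices `A * B = 0` such that the left kernel of `A` and the kernel of `B` contain
only constant vectors is exact in the middle if the dimensions fit. -/
theorem exists_mulVec_eq_of_card [Fintype m] [Fintype k] (A : Matrix m n K) (B : Matrix n k K)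
    (hAB : A * B = 0)
    (hA : ∀ v, Aᵀ *ᵥ v = 0 → ∀ i j, v i = v j) (hB : ∀ v, B *ᵥ v = 0 → ∀ i j, v i = v j)
    (hc : Fintype.card n + 2 ≤ Fintype.card m + Fintype.card k) {c : n → K} (h : A *ᵥ c = 0) :
    ∃ v, B *ᵥ v = c := by
  have hle : LinearMap.range B.mulVecLin ≤ LinearMap.ker A.mulVecLin := by
    rintro _ ⟨v, rfl⟩
    rw [LinearMap.mem_ker, mulVecLin_apply, mulVecLin_apply, mulVec_mulVec, hAB, zero_mulVec]
  have h1 := LinearMap.finrank_range_add_finrank_ker B.mulVecLin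
  have h2 := LinearMap.finrank_range_add_finrank_ker A.mulVecLin
  have h3 := LinearMap.finrank_range_add_finrank_ker Aᵀ.mulVecLin
  have h4 : Module.finrank K (LinearMap.range Aᵀ.mulVecLin) =
    Module.finrank K (LinearMap.range A.mulVecLin) := rank_transpose A
  have h5 := finrank_ker_mulVecLin_le_one _ hA
  have h6 := finrank_ker_mulVecLin_le_one _ hB
  rw [Module.finrank_fintype_fun_eq_card] at h1 h2 h3
  -- The kernel of `A` has dimension at most |n| - |m| + 1, the range of `B` at least |k| - 1, and
  -- `hc` compares the two.
  have heq := Submodule.eq_of_le_of_finrank_le hle (by omega)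
  have hmem : c ∈ LinearMap.range B.mulVecLin := by
    rw [heq, LinearMap.mem_ker]
    exact h
  exact hmem

end Matrix

/-! ### Rays, corners and faces of a diagram -/

namespace KnotDiagram

variable {X : Type*} (D : KnotDiagram X)

/-- Whether a ray leaves its crossing. -/
def isOut (k : X × Fin 4) : Bool := (D.rayEquiv.symm k).2

/-- The passage at which the edge of a ray starts. -/
def edgeOf (k : X × Fin 4) : X × Bool :=
  match D.rayEquiv.symm k with
  | (p, true) => p
  | (p, false) => D.next.symm p

theorem oppositeRay_oppositeRay (k : X × Fin 4) : D.oppositeRay (D.oppositeRay k) = k := by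
  simp only [GaussCode.oppositeRay, Equiv.trans_apply, Equiv.symm_apply_apply]
  rw [← Equiv.eq_symm_apply]
  rcases D.rayEquiv.symm k with ⟨p, _ | _⟩ <;> simp [GaussCode.swapEnds]

theorem isOut_oppositeRay (k : X × Fin 4) : D.isOut (D.oppositeRay k) = !D.isOut k := by
  simp only [isOut, GaussCode.oppositeRay, Equiv.trans_apply, Equiv.symm_apply_apply]
  rcases D.rayEquiv.symm k with ⟨p, _ | _⟩ <;> simp [GaussCode.swapEnds]

theorem oppositeRay_ne (k : X × Fin 4) : D.oppositeRay k ≠ k := fun h => by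
  have := D.isOut_oppositeRay k
  rw [h] at this
  simp at this

theorem edgeOf_oppositeRay (k : X × Fin 4) : D.edgeOf (D.oppositeRay k) = D.edgeOf k := by
  simp only [edgeOf, GaussCode.oppositeRay, Equiv.trans_apply, Equiv.symm_apply_apply]
  rcases D.rayEquiv.symm k with ⟨p, _ | _⟩ <;> simp [GaussCode.swapEnds]

theorem edgeOf_eq_iff {k k' : X × Fin 4} :
    D.edgeOf k = D.edgeOf k' ↔ k' = k ∨ k' = D.oppositeRay k := by
  constructor
  · intro h
    simp only [edgeOf] at h
    simp only [GaussCode.oppositeRay, Equiv.trans_apply, ← Equiv.symm_apply_eq]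
    rw [← D.rayEquiv.symm.injective.eq_iff]
    rcases h1 : D.rayEquiv.symm k with ⟨p, _ | _⟩ <;>
      rcases h2 : D.rayEquiv.symm k' with ⟨p', _ | _⟩ <;>
      simp_all [GaussCode.swapEnds]
    · rw [← Equiv.eq_symm_apply, h1, ← h]
      simp
    · rw [← Equiv.eq_symm_apply, h1]
  · rintro (rfl | rfl)
    · rfl
    · rw [edgeOf_oppositeRay]

theorem edgeOf_out (p : X × Bool) : D.edgeOf (D.rayEquiv (p, true)) = p := by
  simp [edgeOf]

theorem oppositeRay_out (p : X × Bool) :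
    D.oppositeRay (D.rayEquiv (p, true)) = D.rayEquiv (D.next p, false) := by
  simp [GaussCode.oppositeRay, GaussCode.swapEnds]

theorem rayEquiv_fst (p : X × Bool) (b : Bool) : (D.rayEquiv (p, b)).1 = p.1 := by
  rcases p with ⟨c, _ | _⟩ <;> cases b <;> rfl

theorem eq_out_of_isOut {k : X × Fin 4} (h : D.isOut k = true) :
    k = D.rayEquiv (D.edgeOf k, true) := by
  rw [← Equiv.symm_apply_eq, edgeOf]
  simp only [isOut] at h
  rcases h1 : D.rayEquiv.symm k with ⟨p, _ | _⟩ <;> simp_all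

theorem outwardRight_eq (k : X × Fin 4) :
    D.outwardRight k = D.outwardLeft (D.oppositeRay k) := by
  simp only [GaussCode.outwardRight, GaussCode.outwardLeft, GaussCode.oppositeRay,
    Equiv.trans_apply, Equiv.symm_apply_apply]
  rcases D.rayEquiv.symm k with ⟨p, _ | _⟩ <;> simp [GaussCode.swapEnds]

theorem nextAtCrossing_apply (c : X) (i : Fin 4) : nextAtCrossing (c, i) = (c, i + 1) := rfl

theorem nextAtCrossing_fst (k : X × Fin 4) : (nextAtCrossing k).1 = k.1 := rfl

theorem nextAtCrossing_symm_fst (k : X × Fin 4) : (nextAtCrossing.symm k).1 = k.1 := rfl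

theorem nextAtFace_apply (k : X × Fin 4) :
    D.nextAtFace k = nextAtCrossing.symm (D.oppositeRay k) := rfl

/-- The relation α = σφ between the rotations of a map on a surface. A number `k` stands both for a
ray and for the corner that follows it counterclockwise. -/
theorem oppositeRay_eq_mul : (D.oppositeRay : Equiv.Perm (X × Fin 4)) =
    nextAtCrossing * D.nextAtFace :=
  Equiv.ext fun k => by rw [Equiv.Perm.mul_apply, nextAtFace_apply, Equiv.apply_symm_apply]

/-- As this is a fixed-point-free involution, all faces of the graph of all corners are
quadrilaterals, one around each edge of the diagram. -/
theorem boundaryStep_eq : D.boundaryStep = D.oppositeRay :=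
  D.oppositeRay_eq_mul.symm

theorem cornerFace_oppositeRay_nextAtCrossing (k : X × Fin 4) :
    D.cornerFace (D.oppositeRay (nextAtCrossing k)) = D.cornerFace k :=
  (Quot.sound ⟨k.1, k.2, rfl, (D.outwardRight_eq (nextAtCrossing k)).symm⟩).symm

theorem cornerFace_nextAtFace (k : X × Fin 4) : D.cornerFace (D.nextAtFace k) = D.cornerFace k := by
  have h := D.cornerFace_oppositeRay_nextAtCrossing (D.nextAtFace k)
  rw [nextAtFace_apply, Equiv.apply_symm_apply, oppositeRay_oppositeRay] at h
  exact h.symm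

theorem cornerFace_oppositeRay (k : X × Fin 4) :
    D.cornerFace (D.oppositeRay k) = D.cornerFace (nextAtCrossing.symm k) := by
  have h := D.cornerFace_oppositeRay_nextAtCrossing (nextAtCrossing.symm k)
  rwa [Equiv.apply_symm_apply] at h

/-- The ray on whose left-hand side the given side of an edge lies. -/
def sideRay [Nonempty X] : D.Edge × EdgeSide → X × Fin 4
  | (.leaving p, .left) => D.rayEquiv (p, true)
  | (.leaving p, .right) => D.rayEquiv (D.next p, false)
  | (.circle h, _) => absurd h (not_isEmpty_iff.2 inferInstance)

theorem sideRay_outwardLeft [Nonempty X] (k : X × Fin 4) : D.sideRay (D.outwardLeft k) = k := by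
  simp only [GaussCode.outwardLeft]
  rcases h : D.rayEquiv.symm k with ⟨p, _ | _⟩ <;> rw [Equiv.symm_apply_eq] at h <;>
    simp [sideRay, h]

theorem outwardLeft_sideRay [Nonempty X] (s : D.Edge × EdgeSide) :
    D.outwardLeft (D.sideRay s) = s := by
  rcases s with ⟨p | h, _ | _⟩
  · simp [sideRay, GaussCode.outwardLeft]
  · simp [sideRay, GaussCode.outwardLeft]
  · exact absurd h (not_isEmpty_iff.2 inferInstance)
  · exact absurd h (not_isEmpty_iff.2 inferInstance)

theorem cornerFace_surjective [Nonempty X] : Function.Surjective D.cornerFace := by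
  rintro ⟨s⟩
  exact ⟨D.sideRay s, congrArg (Quot.mk _) (D.outwardLeft_sideRay s)⟩

/-- Every side of an edge is the left-hand side of exactly one ray, `sideRay`. In these terms each
generating identification of sides is one step of `nextAtFace`, so the cycle of the ray is well
defined on faces. -/
theorem cornerFace_eq_iff [Finite X] (k k' : X × Fin 4) :
    D.cornerFace k = D.cornerFace k' ↔ D.nextAtFace.SameCycle k k' := by
  constructor
  · intro h
    have : Nonempty X := ⟨k.1⟩
    let r : D.Edge × EdgeSide → Quotient (Equiv.Perm.SameCycle.setoid D.nextAtFace) :=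
      fun s => Quotient.mk _ (D.sideRay s)
    have hr := congrArg (Quot.lift r (by
      rintro _ _ ⟨c, i, rfl, rfl⟩
      apply Quotient.sound
      change D.nextAtFace.SameCycle _ _
      rw [outwardRight_eq, sideRay_outwardLeft, sideRay_outwardLeft,
        ← Equiv.Perm.sameCycle_apply_right, nextAtFace_apply, oppositeRay_oppositeRay,
        ← nextAtCrossing_apply, Equiv.symm_apply_apply])) h
    have h2 : D.nextAtFace.SameCycle (D.sideRay (D.outwardLeft k))
      (D.sideRay (D.outwardLeft k')) := Quotient.exact hr
    rwa [sideRay_outwardLeft, sideRay_outwardLeft] at h2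
  · intro h
    obtain ⟨i, -, rfl⟩ := h.exists_pow_eq'
    clear h
    induction i with
    | zero => rfl
    | succ i ih => rw [pow_succ', Equiv.Perm.mul_apply, cornerFace_nextAtFace, ih]

theorem fst_eq_iff_sameCycle (k k' : X × Fin 4) :
    k.1 = k'.1 ↔ (nextAtCrossing (X := X))⁻¹.SameCycle k k' := by
  rw [Equiv.Perm.sameCycle_inv]
  constructor
  · obtain ⟨c, i⟩ := k
    obtain ⟨c', i'⟩ := k'
    rintro rfl
    have h : ∀ j : Fin 4, nextAtCrossing.SameCycle (c, 0) (c, j) := by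
      intro j
      refine ⟨(j.val : ℤ), ?_⟩
      rw [zpow_natCast]
      fin_cases j <;> rfl
    exact (h i).symm.trans (h i')
  · rintro ⟨i, rfl⟩
    induction i using Int.induction_on with
    | zero => rfl
    | succ i ih => rw [add_comm, zpow_one_add, Equiv.Perm.mul_apply, nextAtCrossing_fst, ← ih]
    | pred i ih =>
      rw [sub_eq_neg_add, zpow_add, zpow_neg_one, Equiv.Perm.mul_apply]
      exact ih

theorem faceAt_leaving_left (p : X × Bool) :
    D.faceAt (.leaving p) .left = D.cornerFace (D.rayEquiv (p, true)) :=
  congrArg (Quot.mk _) (by simp [GaussCode.outwardLeft])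

theorem faceAt_leaving_right (p : X × Bool) :
    D.faceAt (.leaving p) .right = D.cornerFace (D.oppositeRay (D.rayEquiv (p, true))) :=
  congrArg (Quot.mk _) (by rw [oppositeRay_out]; simp [GaussCode.outwardLeft])

theorem crossing_const [Finite X] {β : Type*} (g : X → β)
    (h : ∀ p : X × Bool, g p.1 = g (D.next p).1) (c c' : X) : g c = g c' := by
  obtain ⟨i, -, hi⟩ := (D.single_cycle (c, true) (c', true)).exists_pow_eq'
  have : ∀ i : ℕ, g c = g ((D.next ^ i) (c, true)).1 := by
    intro i
    induction i with
    | zero => rfl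
    | succ i ih => rw [pow_succ', Equiv.Perm.mul_apply, ← h, ← ih]
  rw [this i, hi]

/-- The diagram is connected, because the knot runs through all crossings in one cycle. -/
theorem ray_const [Finite X] {β : Type*} (G : X × Fin 4 → β)
    (h : ∀ k, G (D.oppositeRay k) = G k) (h' : ∀ k, G (nextAtCrossing k) = G k)
    (k k' : X × Fin 4) : G k = G k' := by
  have h0 : ∀ k : X × Fin 4, G k = G (k.1, 0) := by
    rintro ⟨c, i⟩
    have h1 : G (c, 1) = G (c, 0) := h' (c, 0)
    have h2 : G (c, 2) = G (c, 1) := h' (c, 1)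
    have h3 : G (c, 3) = G (c, 2) := h' (c, 2)
    fin_cases i
    · rfl
    · exact h1
    · exact h2.trans h1
    · exact h3.trans (h2.trans h1)
  rw [h0 k, h0 k']
  refine D.crossing_const (fun c => G (c, 0)) (fun p => ?_) _ _
  have h1 := h (D.rayEquiv (p, true))
  rw [oppositeRay_out, h0, h0 (D.rayEquiv (p, true)), rayEquiv_fst, rayEquiv_fst] at h1
  exact h1.symm

theorem face_const [Finite X] [Nonempty X] {β : Type*} (v : D.Face → β)
    (h : ∀ e, v (D.faceAt e .right) = v (D.faceAt e .left)) (y y' : D.Face) : v y = v y' := by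
  obtain ⟨k, rfl⟩ := D.cornerFace_surjective y
  obtain ⟨k', rfl⟩ := D.cornerFace_surjective y'
  have h0 : ∀ k, v (D.cornerFace (D.oppositeRay k)) = v (D.cornerFace k) := by
    intro k
    cases ho : D.isOut k with
    | true =>
      have h1 := h (.leaving (D.edgeOf k))
      rwa [faceAt_leaving_left, faceAt_leaving_right, ← D.eq_out_of_isOut ho] at h1
    | false =>
      have h1 := h (.leaving (D.edgeOf (D.oppositeRay k)))
      rw [faceAt_leaving_left, faceAt_leaving_right, ← D.eq_out_of_isOut
        (by rw [isOut_oppositeRay, ho]; rfl), oppositeRay_oppositeRay] at h1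
      exact h1.symm
  refine D.ray_const (fun k => v (D.cornerFace k)) h0 (fun k => ?_) k k'
  have h1 := D.cornerFace_oppositeRay (nextAtCrossing k)
  rw [Equiv.symm_apply_apply] at h1
  change v (D.cornerFace (nextAtCrossing k)) = v (D.cornerFace k)
  rw [← h0 (nextAtCrossing k), h1]

theorem faceAt_over_out (c : X) : D.faceAt (.leaving (c, true)) .left = D.cornerFace (c, 0) ∧
    D.faceAt (.leaving (c, true)) .right = D.cornerFace (c, 3) := by
  rw [faceAt_leaving_left, faceAt_leaving_right, cornerFace_oppositeRay]
  exact ⟨rfl, rfl⟩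

theorem faceAt_over_in (c : X) :
    D.faceAt (.leaving (D.next.symm (c, true))) .left = D.cornerFace (c, 1) ∧
    D.faceAt (.leaving (D.next.symm (c, true))) .right = D.cornerFace (c, 2) := by
  rw [faceAt_leaving_left, faceAt_leaving_right, oppositeRay_out, Equiv.apply_symm_apply]
  refine ⟨?_, rfl⟩
  rw [← D.cornerFace_nextAtFace, nextAtFace_apply, oppositeRay_out, Equiv.apply_symm_apply]
  rfl

theorem faceAt_under_out (c : X) : D.faceAt (.leaving (c, false)) .left =
      D.cornerFace (c, if D.positive c then 1 else 3) ∧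
    D.faceAt (.leaving (c, false)) .right = D.cornerFace (c, if D.positive c then 0 else 2) := by
  rw [faceAt_leaving_left, faceAt_leaving_right, cornerFace_oppositeRay]
  cases h : D.positive c <;> simp [GaussCode.rayEquiv, h] <;> rfl

theorem faceAt_under_in (c : X) :
    D.faceAt (.leaving (D.next.symm (c, false))) .left =
      D.cornerFace (c, if D.positive c then 2 else 0) ∧
    D.faceAt (.leaving (D.next.symm (c, false))) .right =
      D.cornerFace (c, if D.positive c then 3 else 1) := by
  rw [faceAt_leaving_left, faceAt_leaving_right, oppositeRay_out, Equiv.apply_symm_apply,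
    ← D.cornerFace_nextAtFace (D.rayEquiv (_, true)), nextAtFace_apply, oppositeRay_out,
    Equiv.apply_symm_apply]
  cases h : D.positive c <;> simp [GaussCode.rayEquiv, h] <;> rfl

/-! ### Alexander's numbering of the faces -/

/-- An Alexander numbering increases by one when an edge is crossed from left to right. -/
def IsNumbering (z : D.Face → ℤ) : Prop :=
  ∀ e, z (D.faceAt e .right) = z (D.faceAt e .left) + 1

theorem finite_face [Finite X] : Finite D.Face :=
  Nat.finite_of_card_ne_zero (by rw [D.planar]; omega)

/-- The constant function 1 on the edges is a flow, since two edges leave and two arrive at each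
crossing. By Euler's formula every flow on the sphere is the jump of a potential on the faces, first
with rational values. -/
theorem exists_isNumbering [Finite X] : ∃ z, D.IsNumbering z := by
  classical
  rcases isEmpty_or_nonempty X with hX | hX
  · refine ⟨Quot.lift (fun s => match s.2 with | .left => 0 | .right => 1) ?_, ?_⟩
    · rintro _ _ ⟨c, -⟩
      exact (hX.false c).elim
    · rintro (p | h)
      · exact (hX.false p.1).elim
      · rfl
  have := Fintype.ofFinite X
  have := D.finite_face
  have := Fintype.ofFinite D.Face
  -- Edges are indexed by the passages at which they start. `A` is the net outflow at a crossing,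
  -- `B` the jump of a potential across an edge.
  let A : Matrix X (X × Bool) ℚ := .of fun c p =>
    (if p.1 = c then 1 else 0) - (if (D.next p).1 = c then 1 else 0)
  let B : Matrix (X × Bool) D.Face ℚ := .of fun p y =>
    (if D.faceAt (.leaving p) .right = y then 1 else 0) -
      (if D.faceAt (.leaving p) .left = y then 1 else 0)
  have hA : ∀ h c, (A.mulVec h) c = h (c, true) + h (c, false) -
      (h (D.next.symm (c, true)) + h (D.next.symm (c, false))) := by
    intro h c
    simp only [A, Matrix.mulVec, dotProduct, Matrix.of_apply, sub_mul, Finset.sum_sub_distrib,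
      ite_mul, one_mul, zero_mul]
    congr 1
    · rw [Fintype.sum_prod_type]
      simp [Finset.sum_add_distrib]
    · rw [← Equiv.sum_comp D.next.symm]
      simp only [Equiv.apply_symm_apply]
      rw [Fintype.sum_prod_type]
      simp [Finset.sum_add_distrib]
  have hB : ∀ v p, (B.mulVec v) p =
      v (D.faceAt (.leaving p) .right) - v (D.faceAt (.leaving p) .left) := by
    intro v p
    simp [B, Matrix.mulVec, dotProduct, sub_mul]
  have hAB : A * B = 0 := by
    apply Matrix.mulVec_injective
    ext v c
    rw [← Matrix.mulVec_mulVec, hA, hB, hB, hB, hB, (D.faceAt_over_out c).1,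
      (D.faceAt_over_out c).2, (D.faceAt_over_in c).1, (D.faceAt_over_in c).2,
      (D.faceAt_under_out c).1, (D.faceAt_under_out c).2, (D.faceAt_under_in c).1,
      (D.faceAt_under_in c).2, Matrix.zero_mulVec]
    cases h : D.positive c <;> simp
  obtain ⟨v, hv⟩ := Matrix.exists_mulVec_eq_of_card A B hAB (fun w hw c c' => by
      refine D.crossing_const w (fun p => ?_) c c'
      have := congrFun hw p
      simpa [A, Matrix.mulVec, dotProduct, sub_mul, sub_eq_zero] using this) (fun w hw y y' => by
      refine D.face_const w (fun e => ?_) y y'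
      rcases e with p | h
      · have := congrFun hw p
        rw [hB] at this
        exact sub_eq_zero.1 this
      · exact absurd h (not_isEmpty_iff.2 inferInstance)) (by
      rw [← Nat.card_eq_fintype_card (α := D.Face), D.planar]
      simp
      omega) (c := fun _ => 1) (by
      ext c
      rw [hA]
      simp)
  have hv' : ∀ e, v (D.faceAt e .right) = v (D.faceAt e .left) + 1 := by
    rintro (p | h)
    · have := congrFun hv p
      rw [hB] at this
      linarith
    · exact absurd h (not_isEmpty_iff.2 inferInstance)
  obtain ⟨k⟩ : Nonempty (X × Fin 4) := inferInstance
  -- All jumps are 1, so the fractional part of the potential is the same on all faces; shifted to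
  -- vanish on one face, the potential is integral.
  have hint : ∀ y, ∃ j : ℤ, v y - v (D.cornerFace k) = j := by
    intro y
    have := D.face_const (fun y => Int.fract (v y - v (D.cornerFace k))) (fun e => by
      rw [hv', add_sub_right_comm, Int.fract_add_one]) y (D.cornerFace k)
    simp only [sub_self, Int.fract_zero] at this
    exact ⟨⌊v y - v (D.cornerFace k)⌋, by
      have h2 := Int.floor_add_fract (v y - v (D.cornerFace k))
      rw [this, add_zero] at h2
      exact h2.symm⟩
  choose z hz using hint
  refine ⟨z, fun e => ?_⟩
  have h1 := hz (D.faceAt e .right)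
  have h2 := hz (D.faceAt e .left)
  have h3 := hv' e
  have : ((z (D.faceAt e .right) : ℤ) : ℚ) = z (D.faceAt e .left) + 1 := by linarith
  exact_mod_cast this

/-! ### Sets of edges with a given boundary -/

/-- On the sphere every cycle mod `2` of the graph of all corners is the boundary of a set of
edges of the diagram. -/
theorem exists_boundary_eq [Fintype X] [DecidableEq X] (c : X × Fin 4 → ZMod 2)
    (h₁ : ∀ x, ∑ k, (if k.1 = x then c k else 0) = 0)
    (h₂ : ∀ y, ∑ k, (open Classical in if D.cornerFace k = y then c k else 0) = 0) :
    ∃ h : X × Bool → ZMod 2, ∀ k, h (D.edgeOf k) + h (D.edgeOf (nextAtCrossing k)) = c k := by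
  classical
  rcases isEmpty_or_nonempty X with hX | hX
  · exact ⟨0, fun k => (hX.false k.1).elim⟩
  have := D.finite_face
  have := Fintype.ofFinite D.Face
  -- The boundary maps mod 2 of the graph of all corners, a cell decomposition of the sphere: `A`
  -- from corners to crossings and faces, `B` from quadrilaterals (edges of the diagram) to corners.
  let A : Matrix (X ⊕ D.Face) (X × Fin 4) (ZMod 2) := .of fun v k =>
    Sum.elim (fun x => if k.1 = x then 1 else 0) (fun y => if D.cornerFace k = y then 1 else 0) v
  let B : Matrix (X × Fin 4) (X × Bool) (ZMod 2) := .of fun k p =>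
    (if D.edgeOf k = p then 1 else 0) + (if D.edgeOf (nextAtCrossing k) = p then 1 else 0)
  have hA₁ : ∀ c x, (A.mulVec c) (.inl x) = ∑ k, (if k.1 = x then c k else 0) := by
    intro c x
    simp [A, Matrix.mulVec, dotProduct]
  have hA₂ : ∀ c y, (A.mulVec c) (.inr y) = ∑ k, (if D.cornerFace k = y then c k else 0) := by
    intro c x
    simp [A, Matrix.mulVec, dotProduct]
  have hB : ∀ h k, (B.mulVec h) k = h (D.edgeOf k) + h (D.edgeOf (nextAtCrossing k)) := by
    intro v p
    simp [B, Matrix.mulVec, dotProduct, add_mul, Finset.sum_add_distrib]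
  have hAB : A * B = 0 := by
    apply Matrix.mulVec_injective
    ext h (x | y)
    · rw [← Matrix.mulVec_mulVec, hA₁, Matrix.zero_mulVec]
      simp only [hB, ite_add_zero, Finset.sum_add_distrib]
      rw [← Equiv.sum_comp nextAtCrossing fun k => if k.1 = x then h (D.edgeOf k) else 0]
      simp only [nextAtCrossing_fst]
      exact CharTwo.add_self_eq_zero _
    · rw [← Matrix.mulVec_mulVec, hA₂, Matrix.zero_mulVec]
      simp only [hB, ite_add_zero, Finset.sum_add_distrib]
      rw [← Equiv.sum_comp D.nextAtFace fun k => if D.cornerFace k = y then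
        h (D.edgeOf (nextAtCrossing k)) else 0]
      simp only [cornerFace_nextAtFace]
      simp only [nextAtFace_apply, Equiv.apply_symm_apply,
        edgeOf_oppositeRay]
      exact CharTwo.add_self_eq_zero _
  obtain ⟨h, hh⟩ := Matrix.exists_mulVec_eq_of_card A B hAB (fun w hw v v' => by
      have h1 : ∀ k : X × Fin 4, w (.inl k.1) = w (.inr (D.cornerFace k)) := by
        intro k
        have := congrFun hw k
        simp only [A, Matrix.mulVec, dotProduct, Matrix.transpose_apply, Matrix.of_apply,
          Fintype.sum_sum_type, Sum.elim_inl, Sum.elim_inr, ite_mul, one_mul, zero_mul,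
          Finset.sum_ite_eq, Finset.mem_univ, if_true, Pi.zero_apply] at this
        rw [add_eq_zero_iff_eq_neg, CharTwo.neg_eq] at this
        exact this
      have h2 := D.ray_const (fun k => w (.inl k.1)) (fun k => by
        rw [h1, cornerFace_oppositeRay, ← h1, nextAtCrossing_symm_fst]) (fun k => rfl)
      obtain ⟨k₀⟩ : Nonempty (X × Fin 4) := inferInstance
      have h3 : ∀ v, w v = w (.inl k₀.1) := by
        rintro (x | y)
        · exact h2 (x, 0) k₀
        · obtain ⟨k, rfl⟩ := D.cornerFace_surjective y
          rw [← h1]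
          exact h2 k k₀
      rw [h3 v, h3 v']) (fun w hw p p' => by
      have h1 := D.ray_const (fun k => w (D.edgeOf k)) (fun k => by
        rw [edgeOf_oppositeRay]) (fun k => by
        have := congrFun hw k
        rw [hB, Pi.zero_apply, add_eq_zero_iff_eq_neg, CharTwo.neg_eq] at this
        exact this.symm)
      have h2 := h1 (D.rayEquiv (p, true)) (D.rayEquiv (p', true))
      simpa only [edgeOf_out] using h2) (by
      rw [Fintype.card_sum, ← Nat.card_eq_fintype_card (α := D.Face), D.planar]
      simp
      omega) (c := c) (by
      ext (x | y)
      · rw [hA₁]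
        exact h₁ x
      · rw [hA₂]
        exact h₂ y)
  exact ⟨h, fun k => by rw [← hB, hh]⟩

end KnotDiagram

/-! ### Parity of the number of negative signs. -/

theorem List.prod_units_int_eq (l : List ℤˣ) : l.prod = (-1) ^ l.count (-1) := by
  induction l with
  | nil => rfl
  | cons a l ih =>
    rw [List.prod_cons, ih]
    rcases Int.units_eq_one_or a with rfl | rfl
    · rw [one_mul, List.count_cons_of_ne (by decide)]
    · rw [List.count_cons_self, pow_succ']

theorem List.odd_count_neg_one_iff (l : List ℤˣ) : Odd (l.count (-1)) ↔ l.prod = -1 := by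
  rw [List.prod_units_int_eq]
  refine ⟨fun h => h.neg_one_pow, fun h => ?_⟩
  by_contra hc
  rw [Nat.not_odd_iff_even] at hc
  rw [hc.neg_one_pow] at h
  exact absurd h (by decide)

namespace KnotDiagram

variable {X : Type*} (D : KnotDiagram X)

/-! ### Edges of the Alexander graph -/

section GraphEdge

variable {f g : D.Face}

/-- The corner that is an edge of the Alexander graph. -/
def graphCorner (e : D.GraphEdge f g) : X × Fin 4 := e.1

/-- A corner outside of `f` and `g` as an edge of the Alexander graph. -/
def graphEdge (k : X × Fin 4) (h : D.cornerFace k ≠ f ∧ D.cornerFace k ≠ g) : D.GraphEdge f g :=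
  ⟨k, h⟩

theorem graphCorner_mem (e : D.GraphEdge f g) :
    D.cornerFace (D.graphCorner e) ≠ f ∧ D.cornerFace (D.graphCorner e) ≠ g := e.2

variable {D} in
theorem graphEdge_ext {e e' : D.GraphEdge f g} (h : D.graphCorner e = D.graphCorner e') : e = e' :=
  Subtype.ext h

open Classical in
/-- The edges of the Alexander graph that belong to the markers of a state. -/
noncomputable def markerEdges [Fintype X] (s : X → Fin 4) : Finset (D.GraphEdge f g) :=
  Finset.univ.filter fun e => (D.graphCorner e).2 = s (D.graphCorner e).1

theorem mem_markerEdges [Fintype X] {s : X → Fin 4} {e : D.GraphEdge f g} :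
    e ∈ D.markerEdges s ↔ D.graphCorner e = ((D.graphCorner e).1, s (D.graphCorner e).1) := by
  rw [markerEdges, Finset.mem_filter_univ]
  exact ⟨fun h => Prod.ext rfl h, fun h => congrArg Prod.snd h⟩

end GraphEdge

/-! ### Boundary walks and Kauffman's weighting -/

theorem boundaryWalk_eq (k : X × Fin 4) : D.boundaryWalk k =
    [k, D.nextAtFace k, D.oppositeRay k, nextAtCrossing.symm k] := by
  have h2 : Function.minimalPeriod D.boundaryStep k = 2 := by
    rw [boundaryStep_eq]
    exact Function.minimalPeriod_eq_prime (p := 2) (D.oppositeRay_oppositeRay k)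
      (D.oppositeRay_ne k)
  rw [boundaryWalk, h2, boundaryStep_eq, show List.range 2 = [0, 1] from rfl]
  simp [nextAtFace_apply, oppositeRay_oppositeRay]

/-- The negative corner lies between the two outgoing rays, hence beside each of these and beside no
incoming ray. An edge has one outgoing end, which makes the product around its quadrilateral -1. -/
theorem kauffmanSign_mul (k : X × Fin 4) :
    D.kauffmanSign k * D.kauffmanSign (nextAtCrossing.symm k) =
      if D.isOut k = true then -1 else 1 := by
  obtain ⟨c, i⟩ := k
  have h : nextAtCrossing.symm (c, i) = (c, i - 1) := by
    rw [Equiv.symm_apply_eq, nextAtCrossing_apply, sub_add_cancel]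
  rw [h]
  cases hp : D.positive c <;> fin_cases i <;>
    simp [kauffmanSign, isOut, GaussCode.rayEquiv, hp, show (-1 : Fin 4) = 3 from rfl]

theorem isKasteleyn_kauffmanWeighting (f g : D.Face) :
    D.IsKasteleyn (D.kauffmanWeighting f g) := by
  rintro w ⟨k, hw⟩
  rw [boundaryWalk_eq] at hw
  replace hw : w.map D.graphCorner = _ := hw
  have hl : w.length = 4 := by simpa using congrArg List.length hw
  refine ⟨fun _ => ?_, fun h => by rw [hl] at h; omega⟩
  have h1 : w.map (D.kauffmanWeighting f g) = (w.map D.graphCorner).map D.kauffmanSign := by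
    rw [List.map_map]
    rfl
  rw [List.odd_count_neg_one_iff, h1, hw]
  have h2 := D.kauffmanSign_mul k
  have h3 := D.kauffmanSign_mul (D.oppositeRay k)
  rw [← nextAtFace_apply, isOut_oppositeRay] at h3
  have h4 : ([k, D.nextAtFace k, D.oppositeRay k, nextAtCrossing.symm k].map D.kauffmanSign).prod =
      (D.kauffmanSign k * D.kauffmanSign (nextAtCrossing.symm k)) *
      (D.kauffmanSign (D.oppositeRay k) * D.kauffmanSign (D.nextAtFace k)) := by
    simp only [List.map_cons, List.map_nil, List.prod_cons, List.prod_nil, mul_one]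
    ac_rfl
  rw [h4, h2, h3]
  cases D.isOut k <;> rfl

open Classical in
/-- A weighting of the edges of the Alexander graph, extended by `1` to all corners. -/
noncomputable def extendSign {f g : D.Face} (ε : D.GraphEdge f g → ℤˣ) (k : X × Fin 4) : ℤˣ :=
  if h : D.cornerFace k ≠ f ∧ D.cornerFace k ≠ g then ε (D.graphEdge k h) else 1

theorem extendSign_of_mem {f g : D.Face} (ε : D.GraphEdge f g → ℤˣ) {k : X × Fin 4}
    (h : D.cornerFace k ≠ f ∧ D.cornerFace k ≠ g) : D.extendSign ε k = ε (D.graphEdge k h) :=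
  dif_pos h

/-- The condition at the quadrilateral of one edge, with its four corners grouped by the two ends.
The two hypotheses cover all four corners, since those on the same side of the edge lie in the same
face. -/
theorem IsKasteleyn.mul_eq {f g : D.Face} {ε : D.GraphEdge f g → ℤˣ} (hε : D.IsKasteleyn ε)
    {k : X × Fin 4} (h₁ : D.cornerFace k ≠ f ∧ D.cornerFace k ≠ g)
    (h₂ : D.cornerFace (D.oppositeRay k) ≠ f ∧ D.cornerFace (D.oppositeRay k) ≠ g) :
    (D.extendSign ε k * D.extendSign ε (nextAtCrossing.symm k)) *
      (D.extendSign ε (D.oppositeRay k) *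
        D.extendSign ε (nextAtCrossing.symm (D.oppositeRay k))) = -1 := by
  have h₃ := h₁
  rw [← D.cornerFace_nextAtFace] at h₃
  have h₄ := h₂
  rw [D.cornerFace_oppositeRay] at h₄
  let w : List (D.GraphEdge f g) := 
    [D.graphEdge _ h₁, D.graphEdge _ h₃, D.graphEdge _ h₂, D.graphEdge _ h₄]
  have h := (hε w ⟨k, (D.boundaryWalk_eq k).symm⟩).1 (by simp [w])
  rw [List.odd_count_neg_one_iff] at h
  rw [← nextAtFace_apply, extendSign_of_mem _ _ h₁, extendSign_of_mem _ _ h₂,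
    extendSign_of_mem _ _ h₃, extendSign_of_mem _ _ h₄, ← h]
  simp only [w, List.map_cons, List.map_nil, List.prod_cons, List.prod_nil, mul_one]
  ac_rfl

/-! ### Dimer coverings and states -/

open Classical in
-- A set of edges that covers each crossing once is the choice of a corner at each crossing;
-- covering each remaining face once is then the condition on states. The default value of
-- `extendSign` is never used at a marker.
theorem dimerStateSum_eq [Fintype X] [DecidableEq X] {f g : D.Face} (ε : D.GraphEdge f g → ℤˣ) :
    D.dimerStateSum ε = ∑ s : X → Fin 4 with D.IsState f g s,
      ∏ c, (((D.extendSign ε (c, s c) : ℤ) : ℤ[T;T⁻¹]) * cornerWeight (c, s c)) := by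
  symm
  have hmem : ∀ {s} (hs : D.IsState f g s) c, D.graphEdge (c, s c) (hs.1 c) ∈ D.markerEdges s :=
    fun hs c => D.mem_markerEdges.2 rfl
  refine Finset.sum_bij (fun s _ => D.markerEdges s) ?_ ?_ ?_ ?_
  · intro s hs
    rw [Finset.mem_filter_univ] at hs
    rw [Finset.mem_filter_univ]
    refine ⟨fun c => ⟨D.graphEdge (c, s c) (hs.1 c), ⟨hmem hs c, rfl⟩, ?_⟩, fun y => ?_⟩
    · rintro e ⟨h1, h2⟩
      replace h2 : (D.graphCorner e).1 = c := h2
      apply graphEdge_ext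
      rw [D.mem_markerEdges.1 h1, h2]
      rfl
    · obtain ⟨y, hy⟩ := y
      obtain ⟨c, hc, huniq⟩ := hs.2 y hy.1 hy.2
      refine ⟨D.graphEdge (c, s c) (hs.1 c), ⟨hmem hs c, Subtype.ext hc⟩, ?_⟩
      rintro e ⟨h1, h2⟩
      have h3 : D.cornerFace (D.graphCorner e) = y := congrArg Subtype.val h2
      apply graphEdge_ext
      rw [D.mem_markerEdges.1 h1] at h3 ⊢
      rw [huniq _ h3]
      rfl
  · intro s hs s' hs' h
    rw [Finset.mem_filter_univ] at hs
    funext c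
    have h1 := hmem hs c
    rw [h, D.mem_markerEdges] at h1
    exact congrArg Prod.snd h1
  · intro m hm
    rw [Finset.mem_filter_univ] at hm
    choose e he heu using hm.1
    have hs : ∀ c, (c, (D.graphCorner (e c)).2) = D.graphCorner (e c) :=
      fun c => Prod.ext (he c).2.symm rfl
    have hst : D.IsState f g fun c => (D.graphCorner (e c)).2 := by
      refine ⟨fun c => ?_, fun y hf hg => ?_⟩
      · rw [hs]
        exact D.graphCorner_mem (e c)
      · obtain ⟨k, ⟨hk, hky⟩, hku⟩ := hm.2 ⟨y, hf, hg⟩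
        refine ⟨(D.graphCorner k).1, ?_, ?_⟩
        · simp only
          rw [hs, ← heu (D.graphCorner k).1 k ⟨hk, rfl⟩]
          exact congrArg Subtype.val hky
        · intro c hc
          simp only at hc
          rw [hs] at hc
          rw [← hku (e c) ⟨(he c).1, Subtype.ext hc⟩]
          exact (he c).2.symm
    refine ⟨_, (Finset.mem_filter_univ _).2 hst, ?_⟩
    ext k
    rw [D.mem_markerEdges]
    constructor
    · intro hk
      rw [hs] at hk
      rw [graphEdge_ext hk]
      exact (he _).1
    · intro hk
      rw [hs, ← heu (D.graphCorner k).1 k ⟨hk, rfl⟩]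
  · intro s hs
    rw [Finset.mem_filter_univ] at hs
    refine Finset.prod_bij (fun c _ => D.graphEdge (c, s c) (hs.1 c)) ?_ ?_ ?_ ?_
    · intro c _
      exact hmem hs c
    · intro c _ c' _ h
      exact congrArg (fun k : D.GraphEdge f g => (D.graphCorner k).1) h
    · intro e he
      exact ⟨(D.graphCorner e).1, Finset.mem_univ _, graphEdge_ext (D.mem_markerEdges.1 he).symm⟩
    · intro c _
      rw [extendSign_of_mem _ _ (hs.1 c)]
      rfl

theorem dimerStateSum_kauffmanWeighting [Fintype X] (f g : D.Face) :
    D.dimerStateSum (D.kauffmanWeighting f g) = D.kauffmanStateSum f g := by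
  classical
  rw [dimerStateSum_eq, kauffmanStateSum]
  refine Finset.sum_congr (by ext; simp) fun s hs => Finset.prod_congr rfl fun c _ => ?_
  simp only [Finset.mem_filter, Finset.mem_univ, true_and] at hs
  rw [extendSign_of_mem _ _ (hs.1 c)]
  rfl

/-! ### The edges in an invariant set of rays -/

section EdgeSign

variable [Fintype X] [DecidableEq X] {T : Finset (X × Fin 4)}
  (hT : ∀ k, D.oppositeRay k ∈ T ↔ k ∈ T)

theorem card_eq_two_mul_card_out (hT : ∀ k, D.oppositeRay k ∈ T ↔ k ∈ T) :
    T.card = 2 * (T.filter fun k => D.isOut k = true).card := by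
  rw [← Finset.card_filter_add_card_filter_not (fun k => D.isOut k = true), two_mul]
  congr 1
  refine Finset.card_nbij' D.oppositeRay D.oppositeRay ?_ ?_ ?_ ?_ <;> intro k hk
  · simp_all [isOut_oppositeRay]
  · simp_all [isOut_oppositeRay]
  · exact D.oppositeRay_oppositeRay k
  · exact D.oppositeRay_oppositeRay k

theorem edgeOf_eq_iff_sameCycle (k k' : X × Fin 4) :
    D.edgeOf k = D.edgeOf k' ↔ D.oppositeRay.SameCycle k k' := by
  constructor
  · rw [edgeOf_eq_iff]
    rintro (rfl | rfl)
    · rfl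
    · exact Equiv.Perm.sameCycle_apply_right.2 (Equiv.Perm.SameCycle.refl _ _)
  · intro h
    obtain ⟨i, -, rfl⟩ := h.exists_pow_eq'
    clear h
    induction i with
    | zero => rfl
    | succ i ih => rw [pow_succ', Equiv.Perm.mul_apply, edgeOf_oppositeRay, ih]

theorem sign_oppositeRay_subtypePerm :
    (Equiv.Perm.sign (D.oppositeRay.subtypePerm hT) : ℤˣ) =
      (-1) ^ (T.filter fun k => D.isOut k = true).card := by
  rw [Equiv.Perm.sign_subtypePerm_eq_neg_one_pow D.oppositeRay T hT D.edgeOf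
    fun k _ k' _ => D.edgeOf_eq_iff_sameCycle k k', D.card_eq_two_mul_card_out hT, pow_add, pow_mul]
  have h : T.image D.edgeOf = (T.filter fun k => D.isOut k = true).image D.edgeOf := by
    ext p
    simp only [Finset.mem_image, Finset.mem_filter]
    constructor
    · rintro ⟨k, hk, rfl⟩
      cases ho : D.isOut k with
      | true => exact ⟨k, ⟨hk, ho⟩, rfl⟩
      | false =>
        exact ⟨_, ⟨(hT k).2 hk, by rw [isOut_oppositeRay, ho]; rfl⟩, D.edgeOf_oppositeRay k⟩
    · rintro ⟨k, ⟨hk, -⟩, rfl⟩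
      exact ⟨k, hk, rfl⟩
  rw [h, Finset.card_image_of_injOn]
  · simp
  · intro k hk k' hk' he
    simp only [Finset.coe_filter, Set.mem_ofPred_eq] at hk hk'
    rw [D.eq_out_of_isOut hk.2, he, ← D.eq_out_of_isOut hk'.2]

/-- Each edge of `T` is counted at its outgoing end, and the factors of its two ends are multiplied
together. -/
theorem prod_eq_neg_one_pow_of_mul_oppositeRay (G : X × Fin 4 → ℤˣ)
    (hT : ∀ k, D.oppositeRay k ∈ T ↔ k ∈ T) (hG : ∀ k ∈ T, G k * G (D.oppositeRay k) = -1) :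
    ∏ k ∈ T, G k = (-1) ^ (T.filter fun k => D.isOut k = true).card := by
  rw [← Finset.prod_filter_mul_prod_filter_not T (fun k => D.isOut k = true)]
  have h : ∏ k ∈ T with ¬ D.isOut k = true, G k =
      ∏ k ∈ T with D.isOut k = true, G (D.oppositeRay k) := by
    symm
    refine Finset.prod_nbij' D.oppositeRay D.oppositeRay ?_ ?_ ?_ ?_ ?_ <;> intro k hk
    · simp_all [isOut_oppositeRay]
    · simp_all [isOut_oppositeRay]
    · exact D.oppositeRay_oppositeRay k
    · exact D.oppositeRay_oppositeRay k
    · rfl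
  rw [h, ← Finset.prod_mul_distrib,
    Finset.prod_congr rfl fun k hk => hG k (Finset.mem_filter.1 hk).1, Finset.prod_const]

end EdgeSign

/-! ### The sign of a pair of states -/

theorem exists_ray_of_adjacent [Nonempty X] {f g : D.Face} (h : D.Adjacent f g) :
    ∃ k, D.cornerFace k = f ∧ D.cornerFace (D.oppositeRay k) = g := by
  obtain ⟨p | he, h⟩ := h
  · rw [faceAt_leaving_left, faceAt_leaving_right] at h
    rcases h with ⟨rfl, rfl⟩ | ⟨rfl, rfl⟩
    · exact ⟨_, rfl, rfl⟩
    · exact ⟨_, rfl, by rw [oppositeRay_oppositeRay]⟩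
  · exact absurd he (not_isEmpty_iff.2 inferInstance)

/-- A pair of states, together with the permutation of the crossings that takes a crossing `c` to
the crossing at which the first state marks the face that the second state marks at `c`. -/
structure StatePair (f g : D.Face) where
  s : X → Fin 4
  s' : X → Fin 4
  perm : Equiv.Perm X
  isState : D.IsState f g s
  isState' : D.IsState f g s'
  cornerFace_perm : ∀ c, D.cornerFace (perm c, s (perm c)) = D.cornerFace (c, s' c)

variable {D} in
theorem IsState.eq_of_cornerFace_eq {f g : D.Face} {s : X → Fin 4} (hs : D.IsState f g s) {c c' : X}
    (h : D.cornerFace (c, s c) = D.cornerFace (c', s c')) : c = c' :=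
  (hs.2 _ (hs.1 c').1 (hs.1 c').2).unique h rfl

namespace StatePair

variable {D} {f g : D.Face} (P : D.StatePair f g)

theorem cornerFace_perm_symm (c : X) :
    D.cornerFace (P.perm.symm c, P.s' (P.perm.symm c)) = D.cornerFace (c, P.s c) := by
  rw [← P.cornerFace_perm, Equiv.apply_symm_apply]

theorem perm_eq_self {c : X} (h : P.s c = P.s' c) : P.perm c = c :=
  P.isState.eq_of_cornerFace_eq (by rw [P.cornerFace_perm, h])

theorem perm_symm_eq_self {c : X} (h : P.s c = P.s' c) : P.perm.symm c = c := by
  rw [Equiv.symm_apply_eq, P.perm_eq_self h]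

theorem s_eq_s'_of_perm_eq_self {c : X} (h : P.s (P.perm c) = P.s' (P.perm c)) : P.perm c = c := by
  have := P.perm_eq_self h
  exact P.perm.injective this

variable [DecidableEq X]

/-- The involution that exchanges the two markers at each crossing. -/
def swapAtCrossing : Equiv.Perm (X × Fin 4) :=
  Equiv.prodCongrRight fun c => Equiv.swap (P.s c) (P.s' c)

theorem swapAtCrossing_apply (c : X) (i : Fin 4) :
    P.swapAtCrossing (c, i) = (c, Equiv.swap (P.s c) (P.s' c) i) := rfl

theorem swapAtCrossing_swapAtCrossing (k : X × Fin 4) :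
    P.swapAtCrossing (P.swapAtCrossing k) = k := by
  obtain ⟨c, i⟩ := k
  simp [swapAtCrossing_apply]

theorem swapAtCrossing_eq_iff (k : X × Fin 4) :
    P.swapAtCrossing k = k ↔ (k.2 = P.s k.1 ↔ k.2 = P.s' k.1) := by
  obtain ⟨c, i⟩ := k
  simp only [swapAtCrossing_apply, Prod.mk.injEq, true_and]
  rw [Equiv.swap_apply_def]
  split_ifs <;> grind

/-- The function underlying `swapAtFace`. -/
def swapAtFaceFun (k : X × Fin 4) : X × Fin 4 :=
  -- The order of the cases does not matter: where the two markers at a crossing coincide, `perm`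
  -- fixes the crossing and both branches return `k`.
  if k.2 = P.s' k.1 then (P.perm k.1, P.s (P.perm k.1))
  else if k.2 = P.s k.1 then (P.perm.symm k.1, P.s' (P.perm.symm k.1)) else k

theorem swapAtFaceFun_involutive : Function.Involutive P.swapAtFaceFun := by
  rintro ⟨c, i⟩
  by_cases h1 : i = P.s' c
  · by_cases h2 : P.s (P.perm c) = P.s' (P.perm c)
    · have h3 := P.s_eq_s'_of_perm_eq_self h2
      rw [h3] at h2
      simp [swapAtFaceFun, h1, h3, h2]
    · simp [swapAtFaceFun, h1, h2]
  · by_cases h0 : i = P.s c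
    · simp [swapAtFaceFun, h1, ← h0]
    · simp [swapAtFaceFun, h1, h0]

/-- The involution that exchanges the two markers in each face. -/
def swapAtFace : Equiv.Perm (X × Fin 4) := P.swapAtFaceFun_involutive.toPerm

theorem swapAtFace_apply (k : X × Fin 4) : P.swapAtFace k = P.swapAtFaceFun k := rfl

theorem swapAtFace_swapAtFace (k : X × Fin 4) : P.swapAtFace (P.swapAtFace k) = k :=
  P.swapAtFaceFun_involutive k

theorem swapAtFace_s' (c : X) : P.swapAtFace (c, P.s' c) = (P.perm c, P.s (P.perm c)) := by
  simp [swapAtFace_apply, swapAtFaceFun]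

theorem swapAtFace_s (c : X) :
    P.swapAtFace (c, P.s c) = (P.perm.symm c, P.s' (P.perm.symm c)) := by
  rw [← P.swapAtFace_swapAtFace (P.perm.symm c, _), swapAtFace_s', Equiv.apply_symm_apply]

theorem swapAtFace_of_ne {k : X × Fin 4} (h : k.2 ≠ P.s k.1) (h' : k.2 ≠ P.s' k.1) :
    P.swapAtFace k = k := by
  simp [swapAtFace_apply, swapAtFaceFun, h, h']

theorem cornerFace_swapAtFace (k : X × Fin 4) :
    D.cornerFace (P.swapAtFace k) = D.cornerFace k := by
  obtain ⟨c, i⟩ := k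
  by_cases h : i = P.s c
  · rw [h, swapAtFace_s, cornerFace_perm_symm]
  · by_cases h' : i = P.s' c
    · rw [h', swapAtFace_s', cornerFace_perm]
    · rw [P.swapAtFace_of_ne h h']

/-- The moved corners are those marked by exactly one of the states, the same as for
`swapAtCrossing`. A corner that is fixed because both of its markers coincide stays a mark of its
crossing and face. -/
theorem swapAtFace_eq_iff (k : X × Fin 4) :
    P.swapAtFace k = k ↔ (k.2 = P.s k.1 ↔ k.2 = P.s' k.1) := by
  obtain ⟨c, i⟩ := k
  by_cases h : i = P.s c
  · by_cases h' : i = P.s' c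
    · subst h
      rw [swapAtFace_s, P.perm_symm_eq_self h', ← h']
      simp [h']
    · simp only [h, true_iff]
      rw [swapAtFace_s]
      constructor
      · intro h2
        rw [Prod.mk.injEq] at h2
        rw [← h2.2, h2.1]
      · intro h2
        exact absurd (h.trans h2) h'
  · by_cases h' : i = P.s' c
    · simp only [h', iff_true]
      rw [swapAtFace_s']
      constructor
      · intro h2
        rw [Prod.mk.injEq] at h2
        rw [← h2.2, h2.1]
      · intro h2
        exact absurd (h'.trans h2) h
    · simp [P.swapAtFace_of_ne (k := (c, i)) h h', h, h']

variable [Fintype X]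

/-- The markers of the first state. -/
def markers : Finset (X × Fin 4) := Finset.univ.filter fun k => k.2 = P.s k.1

/-- The markers of both states. -/
def allMarkers : Finset (X × Fin 4) := Finset.univ.filter fun k => k.2 = P.s k.1 ∨ k.2 = P.s' k.1

theorem mem_markers {k : X × Fin 4} : k ∈ P.markers ↔ k.2 = P.s k.1 := by simp [markers]

theorem mem_allMarkers {k : X × Fin 4} :
    k ∈ P.allMarkers ↔ k.2 = P.s k.1 ∨ k.2 = P.s' k.1 := by simp [allMarkers]

theorem cornerFace_of_mem_allMarkers {k : X × Fin 4} (hk : k ∈ P.allMarkers) :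
    D.cornerFace k ≠ f ∧ D.cornerFace k ≠ g := by
  obtain ⟨c, i⟩ := k
  rcases P.mem_allMarkers.1 hk with h | h
  · change i = _ at h
    rw [h]
    exact P.isState.1 c
  · change i = _ at h
    rw [h]
    exact P.isState'.1 c

theorem mark_crossing {w w' : X × Fin 4} (hw : w ∈ P.allMarkers) (hw' : w' ∈ P.allMarkers)
    (h : w.1 = w'.1) : w' = w ∨ w' = P.swapAtCrossing w := by
  obtain ⟨c, i⟩ := w
  obtain ⟨c', i'⟩ := w'
  simp only at h
  subst h
  rw [mem_allMarkers] at hw hw'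
  simp only at hw hw'
  rw [swapAtCrossing_apply]
  simp only [Prod.mk.injEq, true_and]
  rcases hw with rfl | rfl <;> rcases hw' with rfl | rfl <;> simp

theorem mark_face {w w' : X × Fin 4} (hw : w ∈ P.allMarkers) (hw' : w' ∈ P.allMarkers)
    (h : D.cornerFace w = D.cornerFace w') : w' = w ∨ w' = P.swapAtFace w := by
  obtain ⟨c, i⟩ := w
  obtain ⟨c', i'⟩ := w'
  rw [mem_allMarkers] at hw hw'
  simp only at hw hw'
  rcases hw with rfl | rfl <;> rcases hw' with rfl | rfl
  · left
    rw [P.isState.eq_of_cornerFace_eq h]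
  · right
    rw [swapAtFace_s]
    rw [← P.cornerFace_perm_symm] at h
    rw [P.isState'.eq_of_cornerFace_eq h]
  · right
    rw [swapAtFace_s']
    rw [← P.cornerFace_perm] at h
    rw [P.isState.eq_of_cornerFace_eq h]
  · left
    rw [P.isState'.eq_of_cornerFace_eq h]

theorem swapAtCrossing_mem_markers {k : X × Fin 4} (hk : P.swapAtCrossing k ≠ k) :
    P.swapAtCrossing k ∈ P.markers ↔ k ∉ P.markers := by
  obtain ⟨c, i⟩ := k
  rw [Ne, swapAtCrossing_eq_iff] at hk
  simp only [mem_markers, swapAtCrossing_apply] at hk ⊢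
  rw [Equiv.swap_apply_def]
  split_ifs <;> grind

theorem mul_mem_markers (k : X × Fin 4) :
    (P.swapAtFace * P.swapAtCrossing) k ∈ P.markers ↔ k ∈ P.markers := by
  have h1 : ∀ k, k ∈ P.markers → (P.swapAtFace * P.swapAtCrossing) k ∈ P.markers := by
    rintro ⟨c, i⟩ hk
    rw [mem_markers] at hk
    simp only at hk
    rw [Equiv.Perm.mul_apply, swapAtCrossing_apply, hk, Equiv.swap_apply_left, swapAtFace_s',
      mem_markers]
  refine ⟨fun h => ?_, h1 k⟩
  have h2 := (Finset.finite_toSet P.markers)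
  have h3 : Set.MapsTo (P.swapAtFace * P.swapAtCrossing) (P.markers : Set (X × Fin 4)) P.markers :=
    fun k hk => h1 k hk
  have h5 : Set.SurjOn (P.swapAtFace * P.swapAtCrossing) (P.markers : Set (X × Fin 4)) P.markers :=
    ((h2.injOn_iff_bijOn_of_mapsTo h3).1 (Equiv.injective _).injOn).surjOn
  obtain ⟨k', hk', he⟩ := h5 h
  rw [← Equiv.injective _ he]
  exact hk'

/-- From the first marker at `c` the composite goes to the second marker at `c`, and from there to
the first marker in the same face, which sits at `perm c`. -/
theorem sign_subtypePerm_markers :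
    Equiv.Perm.sign ((P.swapAtFace * P.swapAtCrossing).subtypePerm P.mul_mem_markers) =
      Equiv.Perm.sign P.perm := by
  symm
  refine Equiv.Perm.sign_eq_sign_of_equiv _ _
    { toFun := fun c => ⟨(c, P.s c), P.mem_markers.2 rfl⟩
      invFun := fun k => k.1.1
      left_inv := fun c => rfl
      right_inv := fun k => Subtype.ext (Prod.ext rfl (P.mem_markers.1 k.2).symm) } fun c => ?_
  apply Subtype.ext
  change _ = P.swapAtFace (P.swapAtCrossing (c, P.s c))
  rw [swapAtCrossing_apply, Equiv.swap_apply_left, swapAtFace_s']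
  rfl

theorem sum_markers_face (y : D.Face) : open Classical in
    ∑ k, (if D.cornerFace k = y then (if k.2 = P.s k.1 then (1 : ZMod 2) else 0) else 0) =
    ∑ k, (if D.cornerFace k = y then (if k.2 = P.s' k.1 then (1 : ZMod 2) else 0) else 0) := by
  classical
  have h : ∀ s : X → Fin 4,
      ∑ k, (if D.cornerFace k = y then (if k.2 = s k.1 then (1 : ZMod 2) else 0) else 0) =
      ∑ c, if D.cornerFace (c, s c) = y then 1 else 0 := by
    intro s
    rw [Fintype.sum_prod_type]
    refine Finset.sum_congr rfl fun c _ => ?_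
    rw [Finset.sum_eq_single (s c)]
    · simp
    · intro i _ hi
      simp [hi]
    · simp
  rw [h, h, ← Equiv.sum_comp P.perm]
  simp only [P.cornerFace_perm]

/-- Each crossing has one marker of each state and each face equally many of both, so the sum of the
markers is a cycle mod 2 and bounds. A corner lies on the boundary if exactly one of the two rays
beside it is in `T`. -/
theorem exists_region (hfg : D.Adjacent f g) [Nonempty X] : ∃ T : Finset (X × Fin 4),
    (∀ k, D.oppositeRay k ∈ T ↔ k ∈ T) ∧
    (∀ k, (k ∈ T ↔ nextAtCrossing k ∈ T) ↔ (k.2 = P.s k.1 ↔ k.2 = P.s' k.1)) ∧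
    ∃ k, D.cornerFace k = f ∧ D.cornerFace (D.oppositeRay k) = g ∧ k ∉ T := by
  classical
  obtain ⟨k₀, hf, hg⟩ := D.exists_ray_of_adjacent hfg
  obtain ⟨h, hh⟩ := D.exists_boundary_eq (fun k =>
      (if k.2 = P.s k.1 then (1 : ZMod 2) else 0) + (if k.2 = P.s' k.1 then (1 : ZMod 2) else 0))
    (fun x => by
      have h1 : ∀ s : X → Fin 4,
          ∑ k : X × Fin 4, (if k.1 = x then (if k.2 = s k.1 then (1 : ZMod 2) else 0) else 0) =
          1 := by
        intro s
        rw [Finset.sum_eq_single (x, s x)]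
        · simp
        · rintro ⟨c, i⟩ _ hne
          by_cases hc : c = x
          · subst hc
            simp only [if_true]
            rw [if_neg fun h => hne (by rw [h])]
          · simp [hc]
        · simp
      simp only [ite_add_zero, Finset.sum_add_distrib]
      rw [h1, h1]
      rfl)
    (fun y => by
      simp only [ite_add_zero, Finset.sum_add_distrib]
      rw [P.sum_markers_face]
      exact CharTwo.add_self_eq_zero _)
  -- Of the two complementary solutions, the one that omits the edge of `k₀`, which separates `f`
  -- from `g`.
  refine ⟨Finset.univ.filter fun k => h (D.edgeOf k) ≠ h (D.edgeOf k₀), ?_, ?_, k₀, hf, hg, ?_⟩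
  · intro k
    simp [edgeOf_oppositeRay]
  · intro k
    simp only [Finset.mem_filter_univ]
    have h1 : ∀ a b t : ZMod 2, (a ≠ t ↔ b ≠ t) ↔ a + b = 0 := by decide
    rw [h1, hh]
    have h4 : ∀ (p q : Prop) [Decidable p] [Decidable q],
        (if p then (1 : ZMod 2) else 0) + (if q then 1 else 0) = 0 ↔ (p ↔ q) := by
      intro p q _ _
      by_cases hp : p <;> by_cases hq : q <;> simp [hp, hq, CharTwo.add_self_eq_zero]
    exact h4 _ _
  · simp

/-- On the right a corner occurs once for each of the two rays beside it that is in `T`, on the left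
once for each state that marks it. By `hT` these numbers have the same parity, and signs square to
one. -/
theorem prod_extendSign_mul (ε : D.GraphEdge f g → ℤˣ) {T : Finset (X × Fin 4)}
    (hT : ∀ k, (k ∈ T ↔ nextAtCrossing k ∈ T) ↔ (k.2 = P.s k.1 ↔ k.2 = P.s' k.1)) :
    (∏ c, D.extendSign ε (c, P.s c)) * ∏ c, D.extendSign ε (c, P.s' c) =
      ∏ k ∈ T, (D.extendSign ε k * D.extendSign ε (nextAtCrossing.symm k)) := by
  have h : ∀ s : X → Fin 4, ∏ c, D.extendSign ε (c, s c) =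
      ∏ k, if k.2 = s k.1 then D.extendSign ε k else 1 := by
    intro s
    rw [Fintype.prod_prod_type]
    simp
  rw [Finset.prod_mul_distrib, h, h, ← Fintype.prod_ite_mem T, ← Fintype.prod_ite_mem T,
    ← Equiv.prod_comp nextAtCrossing fun k =>
      if k ∈ T then D.extendSign ε (nextAtCrossing.symm k) else 1,
    ← Finset.prod_mul_distrib, ← Finset.prod_mul_distrib]
  refine Finset.prod_congr rfl fun k _ => ?_
  rw [Equiv.symm_apply_apply]
  have key : ∀ (a b p q : Prop) [Decidable a] [Decidable b] [Decidable p] [Decidable q] (u : ℤˣ),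
      ((a ↔ b) ↔ (p ↔ q)) → (if p then u else 1) * (if q then u else 1) =
        (if b then u else 1) * (if a then u else 1) := by
    intro a b p q _ _ _ _ u h
    have h2 := Int.units_mul_self u
    by_cases ha : a <;> by_cases hb : b <;> by_cases hp : p <;> by_cases hq : q <;>
      simp [ha, hb, hp, hq, h2] at h ⊢
  have h3 := key _ _ _ _ (D.extendSign ε k) (hT k)
  rw [h3, mul_comm]

/-- Kasteleyn's theorem for the Alexander graph. -/
theorem sign_perm_eq (hfg : D.Adjacent f g) {ε : D.GraphEdge f g → ℤˣ} (hε : D.IsKasteleyn ε) :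
    (Equiv.Perm.sign P.perm : ℤˣ) =
      (∏ c, D.extendSign ε (c, P.s c)) * ∏ c, D.extendSign ε (c, P.s' c) := by
  rcases isEmpty_or_nonempty X with hX | hX
  · rw [Subsingleton.elim P.perm 1]
    simp
  obtain ⟨T, hα, hT, k₀, hf, hg, hk₀⟩ := P.exists_region hfg
  have hmove : ∀ k, P.swapAtCrossing k = k ↔ P.swapAtFace k = k := fun k => by
    rw [swapAtCrossing_eq_iff, swapAtFace_eq_iff]
  have hmem : ∀ k : X × Fin 4, ¬ (k.2 = P.s k.1 ↔ k.2 = P.s' k.1) → k ∈ P.allMarkers :=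
    fun k hk => by
      rw [mem_allMarkers]
      tauto
  have hp : Equiv.Perm.CutsCycles (nextAtCrossing (X := X))⁻¹ P.swapAtCrossing Prod.fst
      P.allMarkers T :=
    { fiber := fst_eq_iff_sameCycle
      invol := P.swapAtCrossing_swapAtCrossing
      mark := fun w hw w' hw' h => P.mark_crossing hw hw' h
      moved := fun k hk => hmem k (by rwa [Ne, swapAtCrossing_eq_iff] at hk)
      map := fun k => rfl
      cut := fun k => by
        rw [swapAtCrossing_eq_iff, ← hT, ← Equiv.Perm.mul_apply, mul_inv_cancel,
          Equiv.Perm.one_apply]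
        exact ⟨Iff.symm, Iff.symm⟩ }
  have hq : Equiv.Perm.CutsCycles D.nextAtFace P.swapAtFace D.cornerFace P.allMarkers T :=
    { fiber := D.cornerFace_eq_iff
      invol := P.swapAtFace_swapAtFace
      mark := fun w hw w' hw' h => P.mark_face hw hw' h
      moved := fun k hk => hmem k (by rwa [Ne, swapAtFace_eq_iff] at hk)
      map := P.cornerFace_swapAtFace
      cut := fun k => by
        rw [swapAtFace_eq_iff, ← hT, nextAtFace_apply, Equiv.apply_symm_apply, hα]
        exact ⟨Iff.symm, Iff.symm⟩ }
  -- No marker lies in `f` or `g`, so around these faces membership in `T` never changes.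
  have hout : ∀ k₁, k₁ ∉ T → (D.cornerFace k₁ = f ∨ D.cornerFace k₁ = g) →
      ∀ k ∈ T, D.cornerFace k₁ ≠ D.cornerFace k := by
    intro k₁ hk₁ hfg k hk h
    refine hq.fiber_induction (fun j => j ∉ T) hk₁ (fun j hj hjT => ?_) h hk
    have h1 : P.swapAtFace (D.nextAtFace j) = D.nextAtFace j := by
      by_contra h1
      have h2 := P.cornerFace_of_mem_allMarkers (hq.moved _ h1)
      rw [cornerFace_nextAtFace, hj] at h2
      tauto
    rwa [← (hq.cut j).2 h1]
  have hTf : ∀ k ∈ T, D.cornerFace k ≠ f ∧ D.cornerFace k ≠ g := by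
    intro k hk
    have h1 := hout k₀ hk₀ (Or.inl hf) k hk
    have h2 := hout (D.oppositeRay k₀) (by rwa [hα]) (Or.inr hg) k hk
    rw [hf] at h1
    rw [hg] at h2
    exact ⟨h1.symm, h2.symm⟩
  have hU : ∀ k, (P.swapAtFace * P.swapAtCrossing) k ∈ T ↔ k ∈ T := by
    intro k
    rw [Equiv.Perm.mul_apply]
    by_cases h : P.swapAtCrossing k = k
    · rw [h, (hmove k).1 h]
    · have h1 := hp.invol_mem h
      have h2 := hq.invol_mem (k := P.swapAtCrossing k) (by
        rw [Ne, ← hmove, P.swapAtCrossing_swapAtCrossing]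
        exact Ne.symm h)
      tauto
  -- The cycle count on `T` gives the sign of `oppositeRay` there; the next step moves the sign of
  -- the composite from `T` to the markers of the first state.
  have h1 := Equiv.Perm.sign_subtypePerm_mul_of_cutsCycles D.oppositeRay_eq_mul hα hp hq
    (fun k _ => ⟨(k.1, P.s k.1), P.mem_allMarkers.2 (Or.inl rfl), rfl⟩) (fun k hk => by
      obtain ⟨c, hc, -⟩ := P.isState.2 _ (hTf k hk).1 (hTf k hk).2
      exact ⟨(c, P.s c), P.mem_allMarkers.2 (Or.inl rfl), hc⟩) hU
  have h2 := Equiv.Perm.sign_subtypePerm_involutions_eq P.swapAtCrossing P.swapAtFace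
    P.swapAtCrossing_swapAtCrossing P.swapAtFace_swapAtFace hmove P.markers T
    (fun k hk => P.swapAtCrossing_mem_markers hk) (fun k hk => hp.invol_mem hk)
    P.mul_mem_markers hU
  rw [← P.sign_subtypePerm_markers, h2, h1, sign_oppositeRay_subtypePerm,
    P.prod_extendSign_mul ε hT, D.prod_eq_neg_one_pow_of_mul_oppositeRay _ hα]
  intro k hk
  exact hε.mul_eq D (hTf k hk) (hTf _ ((hα k).2 hk))

end StatePair

end KnotDiagram

theorem Int.cast_units_mul_self {R : Type*} [Ring R] (u : ℤˣ) :
    ((u : ℤ) : R) * ((u : ℤ) : R) = 1 := by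
  rcases Int.units_eq_one_or u with rfl | rfl <;> simp

/-! ### Minors of a matrix with two relations between its columns -/

/-- Complete `A` to a square matrix by two unit rows that select the columns omitted by `e`.
Multiply it by the unit columns kept by `e'` together with the two relations 1 and `z`. The
determinant of the product, computed directly and from its factors, gives the two sides; no division
is needed. -/
theorem Matrix.exists_units_smul_det_submatrix {X F R : Type*} [Fintype X] [DecidableEq X]
    [Fintype F] [DecidableEq F] [CommRing R] (A : Matrix X F R) (z : F → R)
    (h₁ : ∀ c, ∑ y, A c y = 0) (hz : ∀ c, ∑ y, A c y * z y = 0) (e e' : X ⊕ Fin 2 ≃ F) :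
    ∃ δ : ℤˣ, (z (e' (.inr 1)) - z (e' (.inr 0))) * (A.submatrix id (e ∘ .inl)).det =
      ((δ : ℤ) : R) * ((z (e (.inr 1)) - z (e (.inr 0))) * (A.submatrix id (e' ∘ .inl)).det) := by
  let E : Matrix (Fin 2) F R := .of fun i y => if y = e (.inr i) then 1 else 0
  let B₁ : Matrix F X R := .of fun y c => if y = e' (.inl c) then 1 else 0
  let B₂ : Matrix F (Fin 2) R := .of fun y i => if i = 0 then 1 else z y
  let Z : (X ⊕ Fin 2 ≃ F) → Matrix (Fin 2) (Fin 2) R := fun e => B₂.submatrix (e ∘ .inr) id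
  have hZ : ∀ e, (Z e).det = z (e (.inr 1)) - z (e (.inr 0)) := by
    intro e
    simp [Z, B₂, Matrix.det_fin_two]
  let P := Matrix.fromRows A E
  let U := Matrix.fromCols B₁ B₂
  have hPU : (P * U).det = (A.submatrix id (e' ∘ .inl)).det * (Z e).det := by
    have h2 : A * B₂ = 0 := by
      ext c i
      fin_cases i
      · simpa [Matrix.mul_apply, B₂] using h₁ c
      · simpa [Matrix.mul_apply, B₂] using hz c
    have h3 : A * B₁ = A.submatrix id (e' ∘ .inl) := by
      ext c c'
      simp [Matrix.mul_apply, B₁]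
    have h4 : E * B₂ = Z e := by
      ext i j
      simp [Matrix.mul_apply, E, Z]
    rw [Matrix.fromRows_mul_fromCols, h2, h3, h4, Matrix.det_fromBlocks_zero₁₂]
  have hP : (P.submatrix id e).det = (A.submatrix id (e ∘ .inl)).det := by
    have h2 : P.submatrix id e =
        Matrix.fromBlocks (A.submatrix id (e ∘ .inl)) (A.submatrix id (e ∘ .inr)) 0 1 := by
      ext (i | i) (j | j) <;> simp [P, E, Matrix.one_apply, eq_comm]
    rw [h2, Matrix.det_fromBlocks_zero₂₁, Matrix.det_one, mul_one]
  have hU' : (U.submatrix e' id).det = (Z e').det := by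
    have h2 : U.submatrix e' id =
        Matrix.fromBlocks 1 (B₂.submatrix (e' ∘ .inl) id) 0 (Z e') := by
      ext (i | i) (j | j) <;> simp [U, B₁, Z, Matrix.one_apply]
    rw [h2, Matrix.det_fromBlocks_zero₂₁, Matrix.det_one, one_mul]
  -- The factors are triangular for different orders of the columns, `e` and `e'`; comparing these
  -- gives the sign.
  have hU : (U.submatrix e id).det =
      Equiv.Perm.sign (e.trans e'.symm) * (U.submatrix e' id).det := by
    rw [← Matrix.det_permute, Matrix.submatrix_submatrix]
    congr 2
    ext i
    simp
  refine ⟨Equiv.Perm.sign (e.trans e'.symm), ?_⟩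
  have h5 : P * U = P.submatrix id e * U.submatrix e id := by
    rw [Matrix.submatrix_mul_equiv, Matrix.submatrix_id_id]
  rw [h5, Matrix.det_mul, hP, hU, hU', hZ, hZ] at hPU
  rw [mul_comm (z (e (.inr 1)) - _), ← hPU]
  linear_combination (-(z (e' (.inr 1)) - z (e' (.inr 0))) * (A.submatrix id (e ∘ .inl)).det) *
    Int.cast_units_mul_self (R := R) (Equiv.Perm.sign (e.trans e'.symm))

namespace KnotDiagram

variable {X : Type*} (D : KnotDiagram X)

/-! ### The Alexander matrix -/

open Classical in
/-- The matrix of the local weights, added up over the corners of a face at a crossing. -/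
noncomputable def weightMatrix : Matrix X D.Face ℤ[T;T⁻¹] :=
  .of fun c y => ∑ i, if D.cornerFace (c, i) = y then cornerWeight (c, i) else 0

open Classical in
/-- Alexander's matrix: the local weights with alternating signs around each crossing. -/
noncomputable def alexanderMatrix : Matrix X D.Face ℤ[T;T⁻¹] :=
  .of fun c y => ∑ i : Fin 4,
    if D.cornerFace (c, i) = y then (-1) ^ (i : ℕ) * cornerWeight (c, i) else 0

variable {D} in
theorem IsNumbering.corner {z : D.Face → ℤ} (hz : D.IsNumbering z) (c : X) :
    z (D.cornerFace (c, 3)) = z (D.cornerFace (c, 0)) + 1 ∧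
    z (D.cornerFace (c, 2)) = z (D.cornerFace (c, 1)) + 1 ∧
    (z (D.cornerFace (c, 0)) = z (D.cornerFace (c, 1)) + 1 ∨
      z (D.cornerFace (c, 1)) = z (D.cornerFace (c, 0)) + 1) := by
  have h1 := hz (.leaving (c, true))
  have h2 := hz (.leaving (D.next.symm (c, true)))
  have h3 := hz (.leaving (D.next.symm (c, false)))
  have h4 := hz (.leaving (c, false))
  rw [(D.faceAt_over_out c).1, (D.faceAt_over_out c).2] at h1
  rw [(D.faceAt_over_in c).1, (D.faceAt_over_in c).2] at h2
  rw [(D.faceAt_under_in c).1, (D.faceAt_under_in c).2] at h3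
  rw [(D.faceAt_under_out c).1, (D.faceAt_under_out c).2] at h4
  refine ⟨h1, h2, ?_⟩
  cases h : D.positive c <;> simp only [h, if_true, if_false, Bool.false_eq_true] at h3 h4
  · exact Or.inr h3
  · exact Or.inl h4

theorem sum_alexanderMatrix_mul [Fintype D.Face] (w : D.Face → ℤ[T;T⁻¹]) (c : X) :
    ∑ y, D.alexanderMatrix c y * w y =
      LaurentPolynomial.T 1 * w (D.cornerFace (c, 0)) -
      LaurentPolynomial.T 1 * w (D.cornerFace (c, 1)) + w (D.cornerFace (c, 2)) -
      w (D.cornerFace (c, 3)) := by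
  classical
  simp only [alexanderMatrix, Matrix.of_apply, Finset.sum_mul, ite_mul, zero_mul]
  rw [Finset.sum_comm]
  simp [Fin.sum_univ_four, cornerWeight]
  ring

theorem sum_alexanderMatrix [Fintype D.Face] (c : X) : ∑ y, D.alexanderMatrix c y = 0 := by
  have := D.sum_alexanderMatrix_mul (fun _ => 1) c
  simpa using this

/-- South is one more than west and east one more than north, so t · north cancels east and t · west
cancels south. -/
theorem sum_alexanderMatrix_mul_T [Fintype D.Face] {z : D.Face → ℤ} (hz : D.IsNumbering z) (c : X) :
    ∑ y, D.alexanderMatrix c y * LaurentPolynomial.T (z y) = 0 := by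
  rw [sum_alexanderMatrix_mul]
  obtain ⟨h1, h2, h3⟩ := hz.corner c
  rw [h1, h2]
  simp only [LaurentPolynomial.T_add]
  ring

/-- Consecutive corners at a crossing have numbers of opposite parity, so the alternating sign is a
sign of the row times a sign of the column. -/
theorem alexanderMatrix_eq_mul_weightMatrix {z : D.Face → ℤ} (hz : D.IsNumbering z) (c : X)
    (y : D.Face) : D.alexanderMatrix c y =
      (((z (D.cornerFace (c, 0))).negOnePow : ℤ) : ℤ[T;T⁻¹]) * (((z y).negOnePow : ℤ) : ℤ[T;T⁻¹]) *
        D.weightMatrix c y := by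
  simp only [alexanderMatrix, weightMatrix, Matrix.of_apply, Finset.mul_sum]
  refine Finset.sum_congr rfl fun i _ => ?_
  split_ifs with h
  · subst h
    congr 1
    obtain ⟨h1, h2, h3⟩ := hz.corner c
    obtain ⟨u, hu⟩ : ∃ u, u = (z (D.cornerFace (c, 0))).negOnePow := ⟨_, rfl⟩
    have n1 : (z (D.cornerFace (c, 1))).negOnePow = -u := by
      rcases h3 with h3 | h3
      · rw [hu, h3, Int.negOnePow_succ, neg_neg]
      · rw [hu, h3, Int.negOnePow_succ]
    have n2 : (z (D.cornerFace (c, 2))).negOnePow = u := by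
      rw [h2, Int.negOnePow_succ, n1, neg_neg]
    have n3 : (z (D.cornerFace (c, 3))).negOnePow = -u := by
      rw [h1, Int.negOnePow_succ, hu]
    rw [← hu]
    obtain rfl | rfl | rfl | rfl : i = 0 ∨ i = 1 ∨ i = 2 ∨ i = 3 := by fin_cases i <;> simp
    · rw [← hu, Int.cast_units_mul_self]
      simp
    · rw [n1, Units.val_neg, Int.cast_neg, mul_neg, Int.cast_units_mul_self]
      simp
    · rw [n2, Int.cast_units_mul_self]
      simp
    · rw [n3, Units.val_neg, Int.cast_neg, mul_neg, Int.cast_units_mul_self]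
      simp [pow_succ]
  · rw [mul_zero]

theorem det_alexanderMatrix_submatrix [Fintype X] [DecidableEq X] (j : X → D.Face) :
    ∃ δ : ℤˣ, (D.alexanderMatrix.submatrix id j).det =
      ((δ : ℤ) : ℤ[T;T⁻¹]) * (D.weightMatrix.submatrix id j).det := by
  obtain ⟨z, hz⟩ := D.exists_isNumbering
  refine ⟨(∏ c, (z (D.cornerFace (c, 0))).negOnePow) * ∏ c, (z (j c)).negOnePow, ?_⟩
  have h : D.alexanderMatrix.submatrix id j =
      .of fun c c' => (((z (j c')).negOnePow : ℤ) : ℤ[T;T⁻¹]) *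
        (Matrix.of fun c c' => (((z (D.cornerFace (c, 0))).negOnePow : ℤ) : ℤ[T;T⁻¹]) *
          D.weightMatrix.submatrix id j c c') c c' := by
    ext1 c c'
    simp only [Matrix.submatrix_apply, id, Matrix.of_apply]
    rw [D.alexanderMatrix_eq_mul_weightMatrix hz]
    ring
  rw [h, Matrix.det_mul_row, Matrix.det_mul_column]
  push_cast
  ring

/-! ### Determinants and state sums -/

section States

variable [Fintype X] [DecidableEq X] {f g : D.Face}

theorem IsState.exists_perm {s : X → Fin 4} (hs : D.IsState f g s) (e : X ≃ D.RemainingFace f g) :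
    ∃ σ : Equiv.Perm X, ∀ c, D.cornerFace (c, s c) = (e (σ c)).1 := by
  have hinj : Function.Injective fun c =>
      e.symm (⟨D.cornerFace (c, s c), hs.1 c⟩ : D.RemainingFace f g) := by
    intro c c' h
    exact hs.eq_of_cornerFace_eq (congrArg Subtype.val (e.symm.injective h))
  refine ⟨Equiv.ofBijective _ (Finite.injective_iff_bijective.1 hinj), fun c => ?_⟩
  rw [Equiv.ofBijective_apply, Equiv.apply_symm_apply]

theorem isState_of_perm {s : X → Fin 4} (e : X ≃ D.RemainingFace f g) (σ : Equiv.Perm X)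
    (h : ∀ c, D.cornerFace (c, s c) = (e (σ c)).1) : D.IsState f g s := by
  refine ⟨fun c => by rw [h]; exact (e (σ c)).2, fun y hf hg => ?_⟩
  refine ⟨σ.symm (e.symm ⟨y, hf, hg⟩), ?_, fun c hc => ?_⟩
  · simp only
    rw [h, Equiv.apply_symm_apply, Equiv.apply_symm_apply]
  · simp only at hc
    rw [h] at hc
    rw [Equiv.eq_symm_apply, Equiv.eq_symm_apply]
    exact Subtype.ext hc

open Classical in
-- A face can have several corners at one crossing, so each entry is a sum over corners; expanding
-- the products gives one term for every choice `s` of corners.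
theorem det_weightMatrix_submatrix (e : X ≃ D.RemainingFace f g) :
    (D.weightMatrix.submatrix id fun c => (e c).1).det =
      ∑ s : X → Fin 4, ∑ σ : Equiv.Perm X, if ∀ c, D.cornerFace (c, s c) = (e (σ c)).1 then
        ((Equiv.Perm.sign σ : ℤ) : ℤ[T;T⁻¹]) * ∏ c, cornerWeight (c, s c) else 0 := by
  rw [← Matrix.det_transpose, Matrix.det_apply', Finset.sum_comm]
  refine Finset.sum_congr rfl fun σ _ => ?_
  simp only [Matrix.transpose_apply, Matrix.submatrix_apply, id, weightMatrix, Matrix.of_apply]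
  rw [Fintype.prod_sum, Finset.mul_sum]
  refine Finset.sum_congr rfl fun s _ => ?_
  rw [Finset.prod_ite_zero, mul_ite, mul_zero]
  simp

theorem exists_det_weightMatrix_eq (hfg : D.Adjacent f g) {ε : D.GraphEdge f g → ℤˣ}
    (hε : D.IsKasteleyn ε) (e : X ≃ D.RemainingFace f g) :
    ∃ δ : ℤˣ, (D.weightMatrix.submatrix id fun c => (e c).1).det =
      ((δ : ℤ) : ℤ[T;T⁻¹]) * D.dimerStateSum ε := by
  classical
  rw [det_weightMatrix_submatrix, dimerStateSum_eq]
  by_cases hst : ∃ s, D.IsState f g s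
  · obtain ⟨s₀, hs₀⟩ := hst
    obtain ⟨σ₀, hσ₀⟩ := hs₀.exists_perm D e
    -- The overall sign is the one at a reference state `s₀`; `sign_perm_eq` compares every other
    -- state with it.
    refine ⟨Equiv.Perm.sign σ₀ * ∏ c, D.extendSign ε (c, s₀ c), ?_⟩
    rw [Finset.mul_sum, Finset.sum_filter]
    refine Finset.sum_congr rfl fun s _ => ?_
    split_ifs with hs
    · obtain ⟨σ, hσ⟩ := hs.exists_perm D e
      rw [Finset.sum_eq_single σ, if_pos hσ]
      · let P : D.StatePair f g :=
          { s := s₀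
            s' := s
            perm := σ.trans σ₀.symm
            isState := hs₀
            isState' := hs
            cornerFace_perm := fun c => by
              rw [hσ₀, hσ, Equiv.trans_apply, Equiv.apply_symm_apply] }
        have h1 := P.sign_perm_eq hfg hε
        simp only [P, Equiv.Perm.sign_trans, Equiv.Perm.sign_symm] at h1
        have h2 : Equiv.Perm.sign σ = Equiv.Perm.sign σ₀ *
            ((∏ c, D.extendSign ε (c, s₀ c)) * ∏ c, D.extendSign ε (c, s c)) := by
          rw [← h1, ← mul_assoc, Int.units_mul_self, one_mul]
        rw [h2, Finset.prod_mul_distrib]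
        push_cast
        ring
      · intro σ' _ hne
        rw [if_neg]
        intro hσ'
        refine hne (Equiv.ext fun c => e.injective (Subtype.ext ?_))
        rw [← hσ, ← hσ']
      · simp
    · refine Finset.sum_eq_zero fun σ _ => ?_
      rw [if_neg]
      exact fun h => hs (D.isState_of_perm e σ h)
  · refine ⟨1, ?_⟩
    rw [Finset.sum_eq_zero, Finset.sum_eq_zero]
    · simp
    · intro s hs
      exact absurd ⟨s, (Finset.mem_filter_univ _).1 hs⟩ hst
    · intro s _
      refine Finset.sum_eq_zero fun σ _ => ?_
      rw [if_neg]
      exact fun h => hst ⟨s, D.isState_of_perm e σ h⟩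

end States

/-! ### The matrix of free derivatives -/

section Fox

variable (a₀ : D.Face)

theorem groupRingMap_of (ψ : D.KnotGroup a₀ →* Multiplicative ℤ)
    (w : FreeGroup {y : D.Face // y ≠ a₀}) :
    D.groupRingMap a₀ ψ (MonoidAlgebra.of ℤ _ w) =
      LaurentPolynomial.T (ψ (D.toKnotGroup a₀ w)).toAdd := by
  simp only [groupRingMap, RingHom.comp_apply, MonoidAlgebra.of_apply]
  simp

variable {a₀} in
theorem IsAbelianizationMap.groupRingMap_of_gen {ψ : D.KnotGroup a₀ →* Multiplicative ℤ}
    (hψ : D.IsAbelianizationMap a₀ ψ) (e : D.Edge) :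
    D.groupRingMap a₀ ψ (MonoidAlgebra.of ℤ _
      (D.gen a₀ (D.faceAt e .right) * (D.gen a₀ (D.faceAt e .left))⁻¹)) =
      LaurentPolynomial.T 1 := by
  rw [groupRingMap_of]
  have := hψ e
  rw [meridian] at this
  rw [this]
  rfl

theorem foxDeriv_inv {α : Type*} (i : α) (w : FreeGroup α) :
    foxDeriv i w⁻¹ = -(MonoidAlgebra.of ℤ (FreeGroup α) w⁻¹ * foxDeriv i w) := by
  have h := foxDeriv_mul i w⁻¹ w
  rw [inv_mul_cancel, foxDeriv_one] at h
  exact eq_neg_of_add_eq_zero_left h.symm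

open Classical in
theorem foxDeriv_gen (y : {y : D.Face // y ≠ a₀}) (x : D.Face) :
    foxDeriv y (D.gen a₀ x) = if x = y.1 then 1 else 0 := by
  rw [gen]
  split_ifs with h1 h2 h2
  · exact absurd (h2.symm.trans h1) y.2
  · rfl
  · rw [foxDeriv_of, if_pos (Subtype.ext h2)]
  · rw [foxDeriv_of, if_neg fun h => h2 (congrArg Subtype.val h)]

variable {a₀} in
-- Both A₄ A₂⁻¹ and A₃ A₁⁻¹ are positive meridians, on the incoming and outgoing half of the
-- over-strand, and map to t. The product rule then leaves the derivatives of A₄, A₂, A₁, A₃ with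
-- coefficients 1, -t, t, -1.
theorem foxMatrix_eq {ψ : D.KnotGroup a₀ →* Multiplicative ℤ} (hψ : D.IsAbelianizationMap a₀ ψ)
    (c : X) (y : {y : D.Face // y ≠ a₀}) : D.foxMatrix a₀ ψ c y = D.alexanderMatrix c y.1 := by
  classical
  have h1 := hψ.groupRingMap_of_gen D (.leaving (c, true))
  have h2 := hψ.groupRingMap_of_gen D (.leaving (D.next.symm (c, true)))
  rw [(D.faceAt_over_out c).1, (D.faceAt_over_out c).2] at h1
  rw [(D.faceAt_over_in c).1, (D.faceAt_over_in c).2] at h2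
  simp only [foxMatrix, Matrix.of_apply, dehnRelator]
  let χ := fun w => D.groupRingMap a₀ ψ (MonoidAlgebra.of ℤ _ w)
  let d := fun w => D.groupRingMap a₀ ψ (foxDeriv y w)
  have hχ : ∀ v w, χ (v * w) = χ v * χ w := fun v w => by simp only [χ, map_mul]
  have hχ1 : χ 1 = 1 := by simp only [χ, map_one]
  have hd : ∀ v w, d (v * w) = d v + χ v * d w := fun v w => by
    simp only [d, χ, foxDeriv_mul, map_mul, map_add]
  have hdi : ∀ w, d w⁻¹ = -(χ w⁻¹ * d w) := fun w => by
    simp only [d, χ, foxDeriv_inv, map_mul, map_neg]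
  have hg : ∀ x, d (D.gen a₀ x) = if x = y.1 then 1 else 0 := fun x => by
    simp only [d, foxDeriv_gen]
    split_ifs
    · exact map_one _
    · exact map_zero _
  change χ _ = _ at h1 h2
  change d _ = _
  have h3 := hχ (D.gen a₀ (D.cornerFace (c, 3)) * (D.gen a₀ (D.cornerFace (c, 0)))⁻¹)
    (D.gen a₀ (D.cornerFace (c, 3)) * (D.gen a₀ (D.cornerFace (c, 0)))⁻¹)⁻¹
  rw [mul_inv_cancel, hχ1, h1] at h3
  rw [hd, hd, hdi (D.gen a₀ (D.cornerFace (c, 1))), hdi (_ * _), hd, hdi, h2]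
  rw [hχ] at h1 h2
  have h4 : D.alexanderMatrix c y.1 =
      LaurentPolynomial.T 1 * d (D.gen a₀ (D.cornerFace (c, 0))) -
      LaurentPolynomial.T 1 * d (D.gen a₀ (D.cornerFace (c, 1))) +
      d (D.gen a₀ (D.cornerFace (c, 2))) - d (D.gen a₀ (D.cornerFace (c, 3))) := by
    rw [hg, hg, hg, hg]
    simp [alexanderMatrix, Fin.sum_univ_four, cornerWeight, pow_succ]
    split_ifs <;> ring
  rw [h4]
  linear_combination (-d (D.gen a₀ (D.cornerFace (c, 1)))) * h2 +
    d (D.gen a₀ (D.cornerFace (c, 0))) * LaurentPolynomial.T 1 *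
      χ (D.gen a₀ (D.cornerFace (c, 3)) * (D.gen a₀ (D.cornerFace (c, 0)))⁻¹)⁻¹ * h1 +
    (d (D.gen a₀ (D.cornerFace (c, 3))) -
      LaurentPolynomial.T 1 * d (D.gen a₀ (D.cornerFace (c, 0)))) * h3

end Fox

/-! ### Existence of the data in the definition of the Alexander polynomial -/

theorem exists_isAbelianizationMap [Finite X] (a₀ : D.Face) :
    ∃ ψ : D.KnotGroup a₀ →* Multiplicative ℤ, D.IsAbelianizationMap a₀ ψ := by
  obtain ⟨z, hz⟩ := D.exists_isNumbering
  let φ : {y : D.Face // y ≠ a₀} → Multiplicative ℤ := fun y => Multiplicative.ofAdd (z y.1 - z a₀)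
  have hφ : ∀ y, FreeGroup.lift φ (D.gen a₀ y) = Multiplicative.ofAdd (z y - z a₀) := by
    intro y
    rw [gen]
    split_ifs with h
    · rw [h, map_one, sub_self]
      rfl
    · rw [FreeGroup.lift_apply_of]
  have hr : ∀ r ∈ Set.range (D.dehnRelator a₀), FreeGroup.lift φ r = 1 := by
    rintro _ ⟨c, rfl⟩
    obtain ⟨h1, h2, -⟩ := hz.corner c
    simp only [dehnRelator, map_mul, map_inv, hφ]
    simp only [← ofAdd_neg, ← ofAdd_add]
    rw [h1, h2]
    convert ofAdd_zero using 2
    ring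
  refine ⟨PresentedGroup.toGroup hr, fun e => ?_⟩
  have h : PresentedGroup.toGroup hr (D.meridian a₀ e) = FreeGroup.lift φ
      (D.gen a₀ (D.faceAt e .right) * (D.gen a₀ (D.faceAt e .left))⁻¹) := rfl
  rw [h, map_mul, map_inv, hφ, hφ, hz e, ← ofAdd_neg, ← ofAdd_add]
  congr 1
  ring

/-- The numbers of the two sides of an edge differ by one. -/
theorem ne_of_adjacent [Finite X] {f g : D.Face} (h : D.Adjacent f g) : f ≠ g := by
  obtain ⟨z, hz⟩ := D.exists_isNumbering
  obtain ⟨e, ⟨rfl, rfl⟩ | ⟨rfl, rfl⟩⟩ := h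
  · intro h
    have := hz e
    rw [h] at this
    omega
  · intro h
    have := hz e
    rw [h] at this
    omega

theorem exists_adjacent (a₀ : D.Face) : ∃ b, D.Adjacent a₀ b := by
  obtain ⟨e, _ | _⟩ := a₀
  · exact ⟨_, e, Or.inl ⟨rfl, rfl⟩⟩
  · exact ⟨_, e, Or.inr ⟨rfl, rfl⟩⟩

theorem nonempty_equiv_remainingFace [Fintype X] {f g : D.Face} (h : f ≠ g) :
    Nonempty (X ≃ D.RemainingFace f g) := by
  classical
  have := D.finite_face
  have := Fintype.ofFinite D.Face
  refine ⟨Fintype.equivOfCardEq ?_⟩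
  have h1 : Fintype.card D.Face = Fintype.card X + 2 := by
    rw [← Nat.card_eq_fintype_card, D.planar, Nat.card_eq_fintype_card]
  have h2 : (Finset.univ.filter fun y : D.Face => y ≠ f ∧ y ≠ g) = ({f, g} : Finset D.Face)ᶜ := by
    ext y
    simp
  rw [Fintype.card_subtype, h2, Finset.card_compl, Finset.card_pair h, h1]
  rfl

/-- A numbering of the faces other than two given ones, extended to all faces. -/
noncomputable def faceEquiv {f g : D.Face} (h : f ≠ g) (e : X ≃ D.RemainingFace f g) :
    X ⊕ Fin 2 ≃ D.Face :=
  Equiv.ofBijective (Sum.elim (fun c => (e c).1) ![f, g]) (by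
    constructor
    · rintro (c | i) (c' | i') hc
      · exact congrArg _ (e.injective (Subtype.ext hc))
      · fin_cases i'
        · exact absurd hc (e c).2.1
        · exact absurd hc (e c).2.2
      · fin_cases i
        · exact absurd hc.symm (e c').2.1
        · exact absurd hc.symm (e c').2.2
      · fin_cases i <;> fin_cases i'
        · rfl
        · exact absurd hc h
        · exact absurd hc.symm h
        · rfl
    · intro y
      by_cases hf : y = f
      · exact ⟨.inr 0, hf.symm⟩
      · by_cases hg : y = g
        · exact ⟨.inr 1, hg.symm⟩
        · exact ⟨.inl (e.symm ⟨y, hf, hg⟩), by simp⟩)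

/-! ### Equality up to units -/

theorem dotEq_iff {p q : ℤ[T;T⁻¹]} :
    DotEq p q ↔ ∃ (k : ℤ) (δ : ℤˣ), p = ((δ : ℤ) : ℤ[T;T⁻¹]) * (LaurentPolynomial.T k * q) := by
  constructor
  · rintro ⟨k, h | h⟩
    · exact ⟨k, 1, by simpa using h⟩
    · exact ⟨k, -1, by simpa using h⟩
  · rintro ⟨k, δ, h⟩
    rcases Int.units_eq_one_or δ with rfl | rfl
    · exact ⟨k, Or.inl (by simpa using h)⟩
    · exact ⟨k, Or.inr (by simpa using h)⟩

theorem DotEq.trans {p q r : ℤ[T;T⁻¹]} (h : DotEq p q) (h' : DotEq q r) : DotEq p r := by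
  rw [dotEq_iff] at *
  obtain ⟨k, δ, rfl⟩ := h
  obtain ⟨k', δ', rfl⟩ := h'
  refine ⟨k + k', δ * δ', ?_⟩
  rw [LaurentPolynomial.T_add]
  push_cast
  ring

theorem T_mul_T_neg (k : ℤ) :
    (LaurentPolynomial.T k : ℤ[T;T⁻¹]) * LaurentPolynomial.T (-k) = 1 := by
  rw [← LaurentPolynomial.T_add, add_neg_cancel, LaurentPolynomial.T_zero]

theorem DotEq.symm {p q : ℤ[T;T⁻¹]} (h : DotEq p q) : DotEq q p := by
  rw [dotEq_iff] at *
  obtain ⟨k, δ, rfl⟩ := h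
  refine ⟨-k, δ, ?_⟩
  linear_combination (-q * LaurentPolynomial.T k * LaurentPolynomial.T (-k)) *
    Int.cast_units_mul_self (R := ℤ[T;T⁻¹]) δ - q * T_mul_T_neg k

theorem T_one_sub_one_ne_zero : (LaurentPolynomial.T 1 - 1 : ℤ[T;T⁻¹]) ≠ 0 := by
  intro h
  rw [← LaurentPolynomial.T_zero, sub_eq_zero] at h
  have h1 := congrArg LaurentPolynomial.degree h
  rw [LaurentPolynomial.degree_T, LaurentPolynomial.degree_T] at h1
  exact absurd h1 (by decide)

theorem T_sub_T_of_adjacent {z : D.Face → ℤ} (hz : D.IsNumbering z) {f g : D.Face}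
    (h : D.Adjacent f g) : DotEq (LaurentPolynomial.T (z g) - LaurentPolynomial.T (z f))
      (LaurentPolynomial.T 1 - 1) := by
  obtain ⟨e, ⟨rfl, rfl⟩ | ⟨rfl, rfl⟩⟩ := h
  · refine ⟨z (D.faceAt e .left), Or.inl ?_⟩
    rw [hz, LaurentPolynomial.T_add]
    ring
  · refine ⟨z (D.faceAt e .left), Or.inr ?_⟩
    rw [hz, LaurentPolynomial.T_add]
    ring

/-- All minors of Alexander's matrix that belong to two adjacent faces agree up to units. -/
theorem dotEq_det_alexanderMatrix [Fintype X] [DecidableEq X] {a b f g : D.Face}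
    (hab : D.Adjacent a b) (hfg : D.Adjacent f g)
    (e : X ≃ D.RemainingFace a b) (e' : X ≃ D.RemainingFace f g) :
    DotEq (D.alexanderMatrix.submatrix id fun c => (e c).1).det
      (D.alexanderMatrix.submatrix id fun c => (e' c).1).det := by
  classical
  have := D.finite_face
  have := Fintype.ofFinite D.Face
  obtain ⟨z, hz⟩ := D.exists_isNumbering
  obtain ⟨δ, h⟩ := D.alexanderMatrix.exists_units_smul_det_submatrix
    (fun y => LaurentPolynomial.T (z y)) D.sum_alexanderMatrix (D.sum_alexanderMatrix_mul_T hz)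
    (D.faceEquiv (D.ne_of_adjacent hab) e) (D.faceEquiv (D.ne_of_adjacent hfg) e')
  change (LaurentPolynomial.T (z g) - LaurentPolynomial.T (z f)) *
    (D.alexanderMatrix.submatrix id fun c => (e c).1).det = _ *
    ((LaurentPolynomial.T (z b) - LaurentPolynomial.T (z a)) *
    (D.alexanderMatrix.submatrix id fun c => (e' c).1).det) at h
  obtain ⟨k, δ₁, h1⟩ := dotEq_iff.1 (D.T_sub_T_of_adjacent hz hfg)
  obtain ⟨l, δ₂, h2⟩ := dotEq_iff.1 (D.T_sub_T_of_adjacent hz hab)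
  rw [h1, h2] at h
  refine DotEq.trans (DotEq.symm (dotEq_iff.2 ⟨k, δ₁, rfl⟩))
    (q := _ * (LaurentPolynomial.T k * _)) (dotEq_iff.2 ⟨l, δ * δ₂, ?_⟩)
  -- Both differences of powers of t are units times t - 1, which cancels because the Laurent
  -- polynomials form a domain.
  apply mul_left_cancel₀ T_one_sub_one_ne_zero
  push_cast
  linear_combination h

/-- The Alexander polynomial is Alexander's determinant, for all choices. -/
theorem isAlexanderPolynomial_iff [Fintype X] [DecidableEq X] (a₀ : D.Face) {f g : D.Face}
    (hfg : D.Adjacent f g) (e' : X ≃ D.RemainingFace f g) (Δ : ℤ[T;T⁻¹]) :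
    D.IsAlexanderPolynomial a₀ Δ ↔
      DotEq Δ (D.alexanderMatrix.submatrix id fun c => (e' c).1).det := by
  have key : ∀ (ψ : D.KnotGroup a₀ →* Multiplicative ℤ) (_ : D.IsAbelianizationMap a₀ ψ)
      (b : D.Face) (_ : D.Adjacent a₀ b) (e : X ≃ {y : {y : D.Face // y ≠ a₀} // y.1 ≠ b}),
      DotEq ((D.foxMatrix a₀ ψ).submatrix id fun c => (e c).1).det
        (D.alexanderMatrix.submatrix id fun c => (e' c).1).det := by
    intro ψ hψ b hb e
    have h := D.dotEq_det_alexanderMatrix hb hfg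
      (e.trans (Equiv.subtypeSubtypeEquivSubtypeInter (· ≠ a₀) (· ≠ b))) e'
    have h2 : (D.foxMatrix a₀ ψ).submatrix id (fun c => (e c).1) =
        D.alexanderMatrix.submatrix id fun c => (e c).1.1 := by
      ext1 c c'
      exact D.foxMatrix_eq hψ _ _
    rw [h2]
    exact h
  constructor
  · rintro ⟨ψ, hψ, b, hb, e, h⟩
    exact h.trans (key ψ hψ b hb e)
  · intro h
    -- For the converse the data in the definition must exist, so that every unit multiple of the
    -- determinant does arise.
    obtain ⟨ψ, hψ⟩ := D.exists_isAbelianizationMap a₀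
    obtain ⟨b, hb⟩ := D.exists_adjacent a₀
    obtain ⟨e₀⟩ := D.nonempty_equiv_remainingFace (D.ne_of_adjacent hb)
    let e := e₀.trans (Equiv.subtypeSubtypeEquivSubtypeInter (· ≠ a₀) (· ≠ b)).symm
    exact ⟨ψ, hψ, b, hb, e, h.trans (key ψ hψ b hb e).symm⟩

theorem dotEq_det_alexanderMatrix_dimerStateSum [Fintype X] [DecidableEq X] {f g : D.Face}
    (hfg : D.Adjacent f g) {ε : D.GraphEdge f g → ℤˣ} (hε : D.IsKasteleyn ε)
    (e : X ≃ D.RemainingFace f g) :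
    DotEq (D.alexanderMatrix.submatrix id fun c => (e c).1).det (D.dimerStateSum ε) := by
  obtain ⟨δ₁, h1⟩ := D.det_alexanderMatrix_submatrix fun c => (e c).1
  obtain ⟨δ₂, h2⟩ := D.exists_det_weightMatrix_eq hfg hε e
  rw [dotEq_iff]
  refine ⟨0, δ₁ * δ₂, ?_⟩
  rw [h1, h2, LaurentPolynomial.T_zero]
  push_cast
  ring

end KnotDiagram

/-! ### The proposition. -/

theorem mainTheorem2 {X : Type*} [Fintype X] [DecidableEq X] (D : KnotDiagram X)
    (a₀ f g : D.Face) (hfg : D.Adjacent f g) :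
    (∀ ε : D.GraphEdge f g → ℤˣ, D.IsKasteleyn ε →
      ∀ Δ : ℤ[T;T⁻¹], D.IsAlexanderPolynomial a₀ Δ ↔
        KnotDiagram.DotEq Δ (D.dimerStateSum ε)) ∧
    D.IsKasteleyn (D.kauffmanWeighting f g) ∧
    D.dimerStateSum (D.kauffmanWeighting f g) = D.kauffmanStateSum f g := by
  refine ⟨fun ε hε Δ => ?_, D.isKasteleyn_kauffmanWeighting f g,
    D.dimerStateSum_kauffmanWeighting f g⟩
  obtain ⟨e⟩ := D.nonempty_equiv_remainingFace (D.ne_of_adjacent hfg)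
  have h := D.dotEq_det_alexanderMatrix_dimerStateSum hfg hε e
  rw [D.isAlexanderPolynomial_iff a₀ hfg e]
  exact ⟨fun h' => h'.trans h, fun h' => h'.trans h.symm⟩
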